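/- Let $N\ge 2$, $s\in(0,1)$, let $\Omega\subset\mathbb R^N$ be a bounded open set, and let $p\in C(\mathbb R^N\times\mathbb R^N)$ be symmetric, $p(x,y)=p(y,x)$, with $$1<p^-:=\inf_{\mathbb R^N\times\mathbb R^N}p\le \sup_{\mathbb R^N\times\mathbb R^N}p=:p^+<\frac Ns .$$ Let $\mathscr W$ be the space of (classes modulo a.e. equality of) measurable functions $u:\mathbb R^N\to\mathbb R$ with $u=0$ a.e. in $\mathbb R^N\setminus\Omega$ such that, for some $\zeta>0$, $$\int_{\mathbb R^N}\Big|\frac{u(x)}{\zeta}\Big|^{p(x,x)}dx<\infty \quad\text{and, for some } \zeta>0,\quad \iint_{\mathbb R^N\times\mathbb R^N}\frac{|u(x)-u(y)|^{p(x,y)}}{\zeta^{p(x,y)}|x-y|^{N+sp(x,y)}}\,dx\,dy<\infty ,$$ normed by $$\|u\|_{\mathscr W}=\inf\Big\{\zeta>0:\iint_{\mathbb R^N\times\mathbb R^N}\frac{|u(x)-u(y)|^{p(x,y)}}{\zeta^{p(x,y)}|x-y|^{N+sp(x,y)}}\,dx\,dy\le1\Big\}.$$ Let $A:\mathbb R^N\times\mathbb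 R^N\times\mathbb R\to\mathbb R$ be measurable (the case in which $A(x,y,t)=A(t)$ does not depend on $(x,y)$ is included), put $\mathcal A(x,y,t)=\int_0^{|t|}A(x,y,\tau)\,d\tau$, and assume that - for all $(x,y)$, $A(x,y,\cdot)$ is continuous and odd and $\mathcal A(x,y,\cdot)$ is strictly convex on $\mathbb R$; - there are constants $c,C>0$ with $A(x,y,t)\,t\ge c|t|^{p(x,y)}$ and $|A(x,y,t)|\le C|t|^{p(x,y)-1}$ for all $x,y,t$; - $A(x,y,t)\,t\le p^+\mathcal A(x,y,t)$ for all $x,y,t$. Let $K:\mathbb R^N\times\mathbb R^N\to[0,\infty)$ be measurable, and assume there are constants $0<b_0\le b_1$ with $b_0\le K(x,y)|x-y|^{N+sp(x,y)}\le b_1$ for all $x\ne y$. Then the functional $$\Phi(u)=\iint_{\mathbb R^N\times\mathbb R^N}\mathcal A\big(x,y,u(x)-u(y)\big)K(x,y)\,dx\,dy$$ has the following properties. 1. $\Phi$ is well defined on $\mathscr W$ (the integrand is integrable for every $u\in\mathscr W$), it is of class $C^1(\mathscr W,\mathbb R)$, and for all $u,v\in\mathscr W$ $$\langle\Phi'(u),v\rangle=\iint_{\mathbb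 R^N\times\mathbb R^N}A\big(x,y,u(x)-u(y)\big)\big(v(x)-v(y)\big)K(x,y)\,dx\,dy,$$ where the integrand is integrable. 2. $\Phi$ is weakly lower semicontinuous: if $u_k\rightharpoonup u$ in $\mathscr W$, then $\Phi(u)\le\liminf_{k\to\infty}\Phi(u_k)$. 3. $\Phi'$ is of type $(S_+)$: if $u_k\rightharpoonup u$ in $\mathscr W$ and $\limsup_{k\to\infty}\langle\Phi'(u_k),u_k-u\rangle\le0$, then $u_k\to u$ in $\mathscr W$. -/

import Mathlib

open MeasureTheory Filter Topology
open scoped ENNReal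

noncomputable section

namespace FracVar

/-! ### Convex modulars on a real vector space -/

/-- An even convex functional with values in `[0, ∞]` that vanishes at the origin. -/
structure IsConvexModular {V : Type*} [AddCommGroup V] [Module ℝ V] (ρ : V → ℝ≥0∞) : Prop where
  zero : ρ 0 = 0
  neg : ∀ v, ρ (-v) = ρ v
  convex : ∀ (v w : V) (a b : ℝ), 0 ≤ a → 0 ≤ b → a + b = 1 →
    ρ (a • v + b • w) ≤ ENNReal.ofReal a * ρ v + ENNReal.ofReal b * ρ w

namespace IsConvexModular

variable {V : Type*} [AddCommGroup V] [Module ℝ V] {ρ : V → ℝ≥0∞}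

theorem smul_le (h : IsConvexModular ρ) (v : V) {a : ℝ} (h0 : 0 ≤ a) (h1 : a ≤ 1) :
    ρ (a • v) ≤ ENNReal.ofReal a * ρ v := by
  have := h.convex v 0 a (1 - a) h0 (by linarith) (by ring)
  simpa [h.zero] using this

theorem add_le (h : IsConvexModular ρ) (v w : V) {ζ η : ℝ} (hζ : 0 < ζ) (hη : 0 < η) :
    ρ ((ζ + η)⁻¹ • (v + w)) ≤ ENNReal.ofReal (ζ / (ζ + η)) * ρ (ζ⁻¹ • v)
      + ENNReal.ofReal (η / (ζ + η)) * ρ (η⁻¹ • w) := by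
  have hs : 0 < ζ + η := by positivity
  have := h.convex (ζ⁻¹ • v) (η⁻¹ • w) (ζ / (ζ + η)) (η / (ζ + η)) (by positivity)
    (by positivity) (by field_simp)
  convert this using 2
  rw [smul_smul, smul_smul, smul_add]
  congr 2 <;> field_simp

theorem smul_abs (h : IsConvexModular ρ) (c : ℝ) (v : V) : ρ (c • v) = ρ (|c| • v) := by
  rcases abs_choice c with hc | hc
  · rw [hc]
  · rw [hc, neg_smul, h.neg]

theorem finite_add (h : IsConvexModular ρ) {v w : V} (hv : ∃ ζ : ℝ, 0 < ζ ∧ ρ (ζ⁻¹ • v) < ∞)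
    (hw : ∃ ζ : ℝ, 0 < ζ ∧ ρ (ζ⁻¹ • w) < ∞) : ∃ ζ : ℝ, 0 < ζ ∧ ρ (ζ⁻¹ • (v + w)) < ∞ := by
  obtain ⟨ζ, hζ, h1⟩ := hv
  obtain ⟨η, hη, h2⟩ := hw
  refine ⟨ζ + η, by positivity, (h.add_le v w hζ hη).trans_lt ?_⟩
  exact ENNReal.add_lt_top.2 ⟨ENNReal.mul_lt_top ENNReal.ofReal_lt_top h1,
    ENNReal.mul_lt_top ENNReal.ofReal_lt_top h2⟩

theorem finite_smul (h : IsConvexModular ρ) {v : V} (c : ℝ)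
    (hv : ∃ ζ : ℝ, 0 < ζ ∧ ρ (ζ⁻¹ • v) < ∞) : ∃ ζ : ℝ, 0 < ζ ∧ ρ (ζ⁻¹ • (c • v)) < ∞ := by
  obtain ⟨ζ, hζ, h1⟩ := hv
  rcases eq_or_ne c 0 with rfl | hc
  · exact ⟨1, one_pos, by simp [h.zero]⟩
  · have hc' : 0 < |c| := abs_pos.2 hc
    refine ⟨|c| * ζ, by positivity, ?_⟩
    rw [smul_smul, h.smul_abs, abs_mul, abs_inv, abs_mul, abs_abs, abs_of_pos hζ]
    have : (|c| * ζ)⁻¹ * |c| = ζ⁻¹ := by field_simp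
    rwa [this]

/-- The Luxemburg functional of a modular. -/
def lux (ρ : V → ℝ≥0∞) (v : V) : ℝ := sInf {ζ : ℝ | 0 < ζ ∧ ρ (ζ⁻¹ • v) ≤ 1}

theorem lux_nonneg (v : V) : 0 ≤ lux ρ v := Real.sInf_nonneg fun _ h => h.1.le

theorem lux_le {v : V} {ζ : ℝ} (hζ : 0 < ζ) (h : ρ (ζ⁻¹ • v) ≤ 1) : lux ρ v ≤ ζ :=
  csInf_le ⟨0, fun _ h => h.1.le⟩ ⟨hζ, h⟩

theorem exists_le_one (h : IsConvexModular ρ) {v : V}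
    (hv : ∃ ζ : ℝ, 0 < ζ ∧ ρ (ζ⁻¹ • v) < ∞) : {ζ : ℝ | 0 < ζ ∧ ρ (ζ⁻¹ • v) ≤ 1}.Nonempty := by
  obtain ⟨ζ, hζ, h1⟩ := hv
  set r := (ρ (ζ⁻¹ • v)).toReal with hr
  have hr0 : 0 ≤ r := ENNReal.toReal_nonneg
  refine ⟨(1 + r) * ζ, by positivity, ?_⟩
  have h2 := h.smul_le (ζ⁻¹ • v) (a := (1 + r)⁻¹) (by positivity)
    (inv_le_one_of_one_le₀ (by linarith))
  rw [smul_smul, ← mul_inv] at h2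
  refine h2.trans ?_
  rw [← ENNReal.ofReal_toReal h1.ne, ← hr, ← ENNReal.ofReal_mul (by positivity)]
  refine ENNReal.ofReal_le_one.2 ?_
  rw [inv_mul_le_iff₀ (by positivity)]
  linarith

theorem lux_smul_le (h : IsConvexModular ρ) {v : V} (c : ℝ)
    (hv : ∃ ζ : ℝ, 0 < ζ ∧ ρ (ζ⁻¹ • v) < ∞) : lux ρ (c • v) ≤ |c| * lux ρ v := by
  rcases eq_or_ne c 0 with rfl | hc
  · simp only [zero_smul, abs_zero, zero_mul]
    refine le_of_forall_pos_le_add fun ε hε => ?_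
    rw [zero_add]
    exact lux_le hε (by simp [h.zero])
  · have hc' : 0 < |c| := abs_pos.2 hc
    rw [← div_le_iff₀' hc']
    refine le_csInf (h.exists_le_one hv) fun ζ hζ => ?_
    rw [div_le_iff₀' hc']
    refine lux_le (mul_pos hc' hζ.1) ?_
    rw [smul_smul, h.smul_abs, abs_mul, abs_inv, abs_mul, abs_abs, abs_of_pos hζ.1]
    have : (|c| * ζ)⁻¹ * |c| = ζ⁻¹ := by have := hζ.1.ne'; field_simp
    rw [this]
    exact hζ.2

theorem lux_smul (h : IsConvexModular ρ) {v : V} (c : ℝ)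
    (hv : ∃ ζ : ℝ, 0 < ζ ∧ ρ (ζ⁻¹ • v) < ∞) : lux ρ (c • v) = |c| * lux ρ v := by
  refine le_antisymm (h.lux_smul_le c hv) ?_
  rcases eq_or_ne c 0 with rfl | hc
  · simpa using lux_nonneg _
  · have hc' : 0 < |c| := abs_pos.2 hc
    have h1 := h.lux_smul_le c⁻¹ (h.finite_smul c hv)
    rw [smul_smul, inv_mul_cancel₀ hc, one_smul, abs_inv, ← div_eq_inv_mul,
      le_div_iff₀' hc'] at h1
    exact h1

theorem lux_add (h : IsConvexModular ρ) {v w : V} (hv : ∃ ζ : ℝ, 0 < ζ ∧ ρ (ζ⁻¹ • v) < ∞)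
    (hw : ∃ ζ : ℝ, 0 < ζ ∧ ρ (ζ⁻¹ • w) < ∞) : lux ρ (v + w) ≤ lux ρ v + lux ρ w := by
  have key : ∀ ζ ∈ {ζ : ℝ | 0 < ζ ∧ ρ (ζ⁻¹ • v) ≤ 1}, ∀ η ∈ {ζ : ℝ | 0 < ζ ∧ ρ (ζ⁻¹ • w) ≤ 1},
      lux ρ (v + w) ≤ ζ + η := by
    rintro ζ ⟨hζ, h1⟩ η ⟨hη, h2⟩
    refine lux_le (by positivity) ((h.add_le v w hζ hη).trans ?_)
    calc _ ≤ ENNReal.ofReal (ζ / (ζ + η)) * 1 + ENNReal.ofReal (η / (ζ + η)) * 1 := by gcongr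
      _ = 1 := by
        rw [mul_one, mul_one, ← ENNReal.ofReal_add (by positivity) (by positivity), ← add_div,
          div_self (by positivity), ENNReal.ofReal_one]
  have h1 : ∀ ζ ∈ {ζ : ℝ | 0 < ζ ∧ ρ (ζ⁻¹ • v) ≤ 1}, lux ρ (v + w) - ζ ≤ lux ρ w := fun ζ hζ =>
    le_csInf (h.exists_le_one hw) fun η hη => by linarith [key ζ hζ η hη]
  have h2 : lux ρ (v + w) - lux ρ w ≤ lux ρ v :=
    le_csInf (h.exists_le_one hv) fun ζ hζ => by linarith [h1 ζ hζ]
  linarith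

theorem eq_zero_of_lux (h : IsConvexModular ρ) {v : V}
    (hv : ∃ ζ : ℝ, 0 < ζ ∧ ρ (ζ⁻¹ • v) < ∞) (h0 : lux ρ v = 0) : ρ v = 0 := by
  refine le_antisymm (ENNReal.le_of_forall_pos_le_add fun ε hε _ => ?_) bot_le
  rw [zero_add]
  have hm : (0 : ℝ) < min ε 1 := lt_min (by exact_mod_cast hε) one_pos
  obtain ⟨ζ, ⟨hζ, h1⟩, h2⟩ := exists_lt_of_csInf_lt (h.exists_le_one hv) (h0.trans_lt hm)
  have h3 := h.smul_le (ζ⁻¹ • v) hζ.le (h2.le.trans (min_le_right _ _))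
  rw [smul_smul, mul_inv_cancel₀ hζ.ne', one_smul] at h3
  calc ρ v ≤ ENNReal.ofReal ζ * 1 := h3.trans (by gcongr)
    _ ≤ ENNReal.ofReal ε := by
      rw [mul_one]; exact ENNReal.ofReal_le_ofReal (h2.le.trans (min_le_left _ _))
    _ = ε := ENNReal.ofReal_coe_nnreal

end IsConvexModular

/-! ### Exponents, domain and modulars -/

/-- `ℝ^N` with its Euclidean norm. -/
abbrev Eu (N : ℕ) : Type := EuclideanSpace ℝ (Fin N)

/-- `p⁻`, the infimum of the exponent over `ℝ^N × ℝ^N`. -/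
def expInf {N : ℕ} (p : Eu N × Eu N → ℝ) : ℝ := ⨅ z, p z

/-- `p⁺`, the supremum of the exponent over `ℝ^N × ℝ^N`. -/
def expSup {N : ℕ} (p : Eu N × Eu N → ℝ) : ℝ := ⨆ z, p z

/-- The standing assumptions on the dimension, the order `s`, the variable exponent `p` and the
set `Ω`. No regularity or connectedness of `Ω` is asked for. -/
structure Standing (N : ℕ) (s : ℝ) (p : Eu N × Eu N → ℝ) (Ω : Set (Eu N)) : Prop where
  two_le : 2 ≤ N
  s_pos : 0 < s
  s_lt_one : s < 1
  cont : Continuous p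
  symm : ∀ x y, p (x, y) = p (y, x)
  bddAbove : BddAbove (Set.range p)
  one_lt_inf : 1 < expInf p
  sup_lt : expSup p < N / s
  isOpen : IsOpen Ω
  bounded : Bornology.IsBounded Ω

/-- The modular `∫ |f(x)|^{p(x,x)} dx` of `L^{p(·)}(ℝ^N)`. -/
def lebModular {N : ℕ} (p : Eu N × Eu N → ℝ) (f : Eu N → ℝ) : ℝ≥0∞ :=
  ∫⁻ x, ENNReal.ofReal (|f x| ^ p (x, x))

/-- The Gagliardo modular `∬ |f(x) - f(y)|^{p(x,y)} / |x - y|^{N + s p(x,y)} dx dy`. -/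
def gagModular {N : ℕ} (s : ℝ) (p : Eu N × Eu N → ℝ) (f : Eu N → ℝ) : ℝ≥0∞ :=
  ∫⁻ z : Eu N × Eu N,
    ENNReal.ofReal (|f z.1 - f z.2| ^ p z / ‖z.1 - z.2‖ ^ ((N : ℝ) + s * p z))

/-- The Gagliardo seminorm `[f]^{s,p(·,·)}` on `ℝ^N` (of Luxemburg type). -/
def gagNorm {N : ℕ} (s : ℝ) (p : Eu N × Eu N → ℝ) (f : Eu N → ℝ) : ℝ :=
  sInf {ζ : ℝ | 0 < ζ ∧ gagModular s p (fun x => f x / ζ) ≤ 1}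

/-- Membership in `W`: `f ∈ L^{p(·)}(ℝ^N)`, the Gagliardo modular of `f / ζ` is finite for some
`ζ > 0`, and `f = 0` almost everywhere outside `Ω`. -/
def MemW {N : ℕ} (s : ℝ) (p : Eu N × Eu N → ℝ) (Ω : Set (Eu N)) (f : Eu N → ℝ) : Prop :=
  (∃ ζ : ℝ, 0 < ζ ∧ lebModular p (fun x => f x / ζ) < ∞) ∧
  (∃ ζ : ℝ, 0 < ζ ∧ gagModular s p (fun x => f x / ζ) < ∞) ∧
  ∀ᵐ x, x ∉ Ω → f x = 0

section helpers

variable {N : ℕ} {s : ℝ} {p : Eu N × Eu N → ℝ} {Ω : Set (Eu N)}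

theorem Standing.one_lt (h : Standing N s p Ω) (z : Eu N × Eu N) : 1 < p z := by
  have hb : BddBelow (Set.range p) := by
    by_contra hb
    have h0 : expInf p = 0 := Real.sInf_of_not_bddBelow hb
    linarith [h.one_lt_inf]
  exact h.one_lt_inf.trans_le (ciInf_le hb z)

theorem abs_rpow_convex {q : ℝ} (hq : 1 ≤ q) (x y a b : ℝ) (ha : 0 ≤ a) (hb : 0 ≤ b)
    (hab : a + b = 1) : |a * x + b * y| ^ q ≤ a * |x| ^ q + b * |y| ^ q := by
  have h1 : |a * x + b * y| ≤ a * |x| + b * |y| := by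
    refine (abs_add_le _ _).trans ?_
    rw [abs_mul, abs_mul, abs_of_nonneg ha, abs_of_nonneg hb]
  refine (Real.rpow_le_rpow (abs_nonneg _) h1 (by linarith)).trans ?_
  have := (convexOn_rpow hq).2 (abs_nonneg x) (abs_nonneg y) ha hb hab
  simpa using this

theorem lebModular_congr {f g : Eu N → ℝ} (h : f =ᵐ[volume] g) :
    lebModular p f = lebModular p g :=
  lintegral_congr_ae (h.mono fun x hx => by simp only [hx])

theorem ae_fst_snd {P : Eu N → Prop} (h : ∀ᵐ x, P x) :
    ∀ᵐ z : Eu N × Eu N, P z.1 ∧ P z.2 :=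
  (Measure.quasiMeasurePreserving_fst.ae h).and (Measure.quasiMeasurePreserving_snd.ae h)

theorem gagModular_congr {f g : Eu N → ℝ} (h : f =ᵐ[volume] g) :
    gagModular s p f = gagModular s p g :=
  lintegral_congr_ae ((ae_fst_snd h).mono fun z hz => by simp only [hz.1, hz.2])

theorem coe_inv_smul (ζ : ℝ) (u : Eu N →ₘ[volume] ℝ) :
    ⇑(ζ⁻¹ • u) =ᵐ[volume] fun x => u x / ζ := by
  filter_upwards [AEEqFun.coeFn_smul ζ⁻¹ u] with x hx
  rw [hx, Pi.smul_apply, smul_eq_mul, div_eq_inv_mul]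

theorem coe_comb (a b : ℝ) (u v : Eu N →ₘ[volume] ℝ) :
    ⇑(a • u + b • v) =ᵐ[volume] fun x => a * u x + b * v x := by
  filter_upwards [AEEqFun.coeFn_add (a • u) (b • v), AEEqFun.coeFn_smul a u,
    AEEqFun.coeFn_smul b v] with x h1 h2 h3
  simp [h1, h2, h3]

theorem lebModular_isConvexModular (h : Standing N s p Ω) :
    IsConvexModular fun u : Eu N →ₘ[volume] ℝ => lebModular p u where
  zero := by
    rw [lebModular_congr AEEqFun.coeFn_zero]
    simp [lebModular, fun x => Real.zero_rpow (one_pos.trans (h.one_lt x)).ne']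
  neg u := by
    rw [lebModular_congr (AEEqFun.coeFn_neg u)]
    simp [lebModular]
  convex u v a b ha hb hab := by
    have hp : Measurable fun x : Eu N => p (x, x) :=
      (h.cont.comp (continuous_id.prodMk continuous_id)).measurable
    have hu : Measurable u := u.stronglyMeasurable.measurable
    rw [lebModular_congr (coe_comb a b u v)]
    unfold lebModular
    rw [← lintegral_const_mul' _ _ ENNReal.ofReal_ne_top,
      ← lintegral_const_mul' _ _ ENNReal.ofReal_ne_top, ← lintegral_add_left (((hu.abs.pow hp).ennreal_ofReal).const_mul _)]
    refine lintegral_mono fun x => ?_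
    rw [← ENNReal.ofReal_mul ha, ← ENNReal.ofReal_mul hb,
      ← ENNReal.ofReal_add (by positivity) (by positivity)]
    exact ENNReal.ofReal_le_ofReal (abs_rpow_convex (h.one_lt _).le _ _ a b ha hb hab)

theorem gagModular_isConvexModular (h : Standing N s p Ω) :
    IsConvexModular fun u : Eu N →ₘ[volume] ℝ => gagModular s p u where
  zero := by
    rw [gagModular_congr AEEqFun.coeFn_zero]
    simp [gagModular, fun x => Real.zero_rpow (one_pos.trans (h.one_lt x)).ne']
  neg u := by
    rw [gagModular_congr (AEEqFun.coeFn_neg u)]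
    unfold gagModular
    refine lintegral_congr fun z => ?_
    rw [Pi.neg_apply, Pi.neg_apply, neg_sub_neg, abs_sub_comm]
  convex u v a b ha hb hab := by
    have hp : Measurable p := h.cont.measurable
    have hu : Measurable u := u.stronglyMeasurable.measurable
    rw [gagModular_congr (coe_comb a b u v)]
    unfold gagModular
    rw [← lintegral_const_mul' _ _ ENNReal.ofReal_ne_top,
      ← lintegral_const_mul' _ _ ENNReal.ofReal_ne_top, ← lintegral_add_left (by fun_prop)]
    refine lintegral_mono fun z => ?_
    rw [← ENNReal.ofReal_mul ha, ← ENNReal.ofReal_mul hb,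
      ← ENNReal.ofReal_add (by positivity) (by positivity)]
    refine ENNReal.ofReal_le_ofReal ?_
    have h1 := abs_rpow_convex (h.one_lt z).le (u z.1 - u z.2) (v z.1 - v z.2) a b ha hb hab
    rw [← mul_div_assoc, ← mul_div_assoc, ← add_div]
    refine div_le_div_of_nonneg_right ?_ (by positivity)
    have h2 : a * (u z.1 - u z.2) + b * (v z.1 - v z.2) =
        a * u z.1 + b * v z.1 - (a * u z.2 + b * v z.2) := by ring
    rw [h2] at h1
    exact h1

theorem gagNorm_eq_lux (u : Eu N →ₘ[volume] ℝ) :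
    gagNorm s p u =
      IsConvexModular.lux (fun u : Eu N →ₘ[volume] ℝ => gagModular s p u) u := by
  unfold gagNorm IsConvexModular.lux
  simp only [gagModular_congr (coe_inv_smul _ u)]

theorem MemW.leb {u : Eu N →ₘ[volume] ℝ} (h : MemW s p Ω u) :
    ∃ ζ : ℝ, 0 < ζ ∧ (fun u : Eu N →ₘ[volume] ℝ => lebModular p u) (ζ⁻¹ • u) < ∞ := by
  simpa only [lebModular_congr (coe_inv_smul _ u)] using h.1

theorem MemW.gag {u : Eu N →ₘ[volume] ℝ} (h : MemW s p Ω u) :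
    ∃ ζ : ℝ, 0 < ζ ∧ (fun u : Eu N →ₘ[volume] ℝ => gagModular s p u) (ζ⁻¹ • u) < ∞ := by
  simpa only [gagModular_congr (coe_inv_smul _ u)] using h.2.1

theorem memW_of {u : Eu N →ₘ[volume] ℝ}
    (h1 : ∃ ζ : ℝ, 0 < ζ ∧ (fun u : Eu N →ₘ[volume] ℝ => lebModular p u) (ζ⁻¹ • u) < ∞)
    (h2 : ∃ ζ : ℝ, 0 < ζ ∧ (fun u : Eu N →ₘ[volume] ℝ => gagModular s p u) (ζ⁻¹ • u) < ∞)
    (h3 : ∀ᵐ x, x ∉ Ω → u x = 0) : MemW s p Ω u := by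
  refine ⟨?_, ?_, h3⟩
  · simpa only [lebModular_congr (coe_inv_smul _ u)] using h1
  · simpa only [gagModular_congr (coe_inv_smul _ u)] using h2

end helpers

/-! ### The space `W` -/

/-- `W` as a linear subspace of the space of classes, modulo equality almost everywhere, of
measurable functions on `ℝ^N`. -/
def subW {N : ℕ} {s : ℝ} {p : Eu N × Eu N → ℝ} {Ω : Set (Eu N)} (h : Standing N s p Ω) :
    Submodule ℝ (Eu N →ₘ[(volume : Measure (Eu N))] ℝ) where
  carrier := {u | MemW s p Ω u}
  zero_mem' := by
    refine memW_of ⟨1, one_pos, ?_⟩ ⟨1, one_pos, ?_⟩ ?_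
    · rw [smul_zero]; refine (lebModular_isConvexModular h).zero.trans_lt ?_; exact ENNReal.zero_lt_top
    · rw [smul_zero]; refine (gagModular_isConvexModular h).zero.trans_lt ?_; exact ENNReal.zero_lt_top
    · filter_upwards [AEEqFun.coeFn_zero (μ := (volume : Measure (Eu N))) (β := ℝ)] with x hx _
      exact hx
  add_mem' := by
    intro u v hu hv
    refine memW_of ((lebModular_isConvexModular h).finite_add hu.leb hv.leb)
      ((gagModular_isConvexModular h).finite_add hu.gag hv.gag) ?_
    filter_upwards [AEEqFun.coeFn_add u v, hu.2.2, hv.2.2] with x h1 h2 h3 hx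
    rw [h1, Pi.add_apply, h2 hx, h3 hx, add_zero]
  smul_mem' := by
    intro c u hu
    refine memW_of ((lebModular_isConvexModular h).finite_smul c hu.leb)
      ((gagModular_isConvexModular h).finite_smul c hu.gag) ?_
    filter_upwards [AEEqFun.coeFn_smul c u, hu.2.2] with x h1 h2 hx
    rw [h1, Pi.smul_apply, h2 hx, smul_zero]

/-- The space `W = W_0^{s,p(·,·)}`. -/
def W {N : ℕ} {s : ℝ} {p : Eu N × Eu N → ℝ} {Ω : Set (Eu N)} (h : Standing N s p Ω) : Type :=
  subW h

namespace W

variable {N : ℕ} {s : ℝ} {p : Eu N × Eu N → ℝ} {Ω : Set (Eu N)} {h : Standing N s p Ω}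

instance : AddCommGroup (W h) := inferInstanceAs (AddCommGroup (subW h))

instance : Module ℝ (W h) := inferInstanceAs (Module ℝ (subW h))

/-- The class modulo equality almost everywhere underlying an element of `W`. -/
def toClass (u : W h) : Eu N →ₘ[(volume : Measure (Eu N))] ℝ := Subtype.val u

/-- A measurable representative of an element of `W`. -/
instance : CoeFun (W h) fun _ => Eu N → ℝ := ⟨fun u => u.toClass⟩

theorem memW (u : W h) : MemW s p Ω u := Subtype.property u

/-- `‖u‖_W` is the Gagliardo seminorm of `u` on `ℝ^N`. -/
instance : Norm (W h) := ⟨fun u => gagNorm s p u⟩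

theorem norm_def (u : W h) : ‖u‖ = gagNorm s p u := rfl

theorem norm_eq_lux (u : W h) :
    ‖u‖ = IsConvexModular.lux (fun u : Eu N →ₘ[volume] ℝ => gagModular s p u) u.toClass :=
  gagNorm_eq_lux _

theorem eq_zero_of_norm {u : W h} (hu : ‖u‖ = 0) : u = 0 := by
  rw [norm_eq_lux] at hu
  have h0 : gagModular s p u = 0 :=
    (gagModular_isConvexModular h).eq_zero_of_lux u.memW.gag hu
  have hp : Measurable p := h.cont.measurable
  have hm : Measurable u := u.toClass.stronglyMeasurable.measurable
  have hN : 0 < N := by have := h.two_le; omega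
  have : Nonempty (Fin N) := ⟨⟨0, hN⟩⟩
  have : Nontrivial (Eu N) := inferInstance
  unfold gagModular at h0
  rw [lintegral_eq_zero_iff (by fun_prop)] at h0
  have h1 : ∀ᵐ z : Eu N × Eu N, u z.1 = u z.2 := by
    filter_upwards [h0] with z hz
    simp only [Pi.zero_apply, ENNReal.ofReal_eq_zero] at hz
    by_contra hne
    have hz12 : z.1 ≠ z.2 := fun h => hne (by rw [h])
    have h2 : 0 < |u z.1 - u z.2| := abs_pos.2 (sub_ne_zero.2 hne)
    have h3 : 0 < ‖z.1 - z.2‖ := norm_pos_iff.2 (sub_ne_zero.2 hz12)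
    have : 0 < |u z.1 - u z.2| ^ p z / ‖z.1 - z.2‖ ^ ((N : ℝ) + s * p z) := by positivity
    linarith
  have h2 : ∀ᵐ x : Eu N, ∀ᵐ y : Eu N, u x = u y := Measure.ae_ae_of_ae_prod h1
  have hΩ : volume Ωᶜ ≠ 0 := by
    intro hc
    have hfin : volume Ω < ∞ := h.bounded.measure_lt_top
    have hle : volume (Set.univ : Set (Eu N)) ≤ volume Ω + volume Ωᶜ := by
      rw [← Set.union_compl_self Ω]; exact measure_union_le _ _
    rw [hc, add_zero] at hle
    have huniv : volume (Set.univ : Set (Eu N)) = ∞ := measure_univ_of_isAddLeftInvariant _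
    rw [huniv] at hle
    exact absurd hfin (not_lt.2 hle)
  have h3 : ∀ᵐ x : Eu N, u x = 0 := by
    filter_upwards [h2] with x hx
    have h4 : ∀ᵐ y : Eu N, y ∉ Ω → u x = 0 := by
      filter_upwards [hx, u.memW.2.2] with y hy hy' hyΩ
      rw [hy, hy' hyΩ]
    by_contra hne
    exact hΩ (measure_mono_null (fun y hy => by simpa [hne] using hy) (ae_iff.1 h4))
  refine Subtype.ext (AEEqFun.ext ?_)
  filter_upwards [h3, AEEqFun.coeFn_zero (μ := (volume : Measure (Eu N))) (β := ℝ)] with x hx hx'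
  exact hx.trans hx'.symm

theorem core : NormedSpace.Core ℝ (W h) where
  norm_nonneg u := by rw [norm_eq_lux]; exact IsConvexModular.lux_nonneg _
  norm_smul c u := by
    rw [norm_eq_lux, norm_eq_lux, Real.norm_eq_abs]
    exact (gagModular_isConvexModular h).lux_smul c u.memW.gag
  norm_triangle u v := by
    rw [norm_eq_lux, norm_eq_lux, norm_eq_lux]
    exact (gagModular_isConvexModular h).lux_add u.memW.gag v.memW.gag
  norm_eq_zero_iff u := by
    refine ⟨eq_zero_of_norm, ?_⟩
    rintro rfl
    rw [norm_eq_lux]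
    have := (gagModular_isConvexModular h).lux_smul 0 (0 : W h).memW.gag
    rw [zero_smul, abs_zero, zero_mul] at this
    exact this

instance : NormedAddCommGroup (W h) := NormedAddCommGroup.ofCore core

instance : NormedSpace ℝ (W h) := NormedSpace.ofCore core

end W

/-! ### The nonlinearity, the kernel and the functional -/

/-- The primitive `t ↦ ∫₀^{|t|} A(z, τ) dτ`, where `z = (x, y)`. -/
def primA {N : ℕ} (A : Eu N × Eu N → ℝ → ℝ) (z : Eu N × Eu N) (t : ℝ) : ℝ :=
  ∫ τ in (0 : ℝ)..|t|, A z τ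

/-- The hypotheses on the nonlinearity `A(x, y, t)`. A nonlinearity `A(t)` that does not depend on
the point `(x, y)` is the case of a constant function of `z`. -/
structure NonlinearityCond {N : ℕ} (p : Eu N × Eu N → ℝ) (A : Eu N × Eu N → ℝ → ℝ) : Prop where
  measurable : Measurable (Function.uncurry A)
  continuous : ∀ z, Continuous (A z)
  odd : ∀ z t, A z (-t) = -A z t
  strictConvex : ∀ z, StrictConvexOn ℝ Set.univ (primA A z)
  growth : ∃ c C : ℝ, 0 < c ∧ 0 < C ∧ ∀ z t,
    c * |t| ^ p z ≤ A z t * t ∧ |A z t| ≤ C * |t| ^ (p z - 1)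
  le_primitive : ∀ z t, A z t * t ≤ expSup p * primA A z t

/-- The hypotheses on the kernel `K`. -/
structure KernelCond {N : ℕ} (s : ℝ) (p : Eu N × Eu N → ℝ) (K : Eu N × Eu N → ℝ) : Prop where
  measurable : Measurable K
  nonneg : ∀ z, 0 ≤ K z
  bounds : ∃ b₀ b₁ : ℝ, 0 < b₀ ∧ b₀ ≤ b₁ ∧ ∀ x y : Eu N, x ≠ y →
    b₀ ≤ K (x, y) * ‖x - y‖ ^ ((N : ℝ) + s * p (x, y)) ∧
      K (x, y) * ‖x - y‖ ^ ((N : ℝ) + s * p (x, y)) ≤ b₁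

/-- The functional `Φ(u) = ∬ 𝒜(x, y, u(x) - u(y)) K(x, y) dx dy` on `W`, where `𝒜` is the
primitive of `A`. -/
def Phi {N : ℕ} {s : ℝ} {p : Eu N × Eu N → ℝ} {Ω : Set (Eu N)} (h : Standing N s p Ω)
    (A : Eu N × Eu N → ℝ → ℝ) (K : Eu N × Eu N → ℝ) (u : W h) : ℝ :=
  ∫ z : Eu N × Eu N, primA A z (u z.1 - u z.2) * K z

/-- Weak convergence `u_k ⇀ v` of a sequence in a normed space. -/
def WeakTendsto {V : Type*} [NormedAddCommGroup V] [NormedSpace ℝ V] (u : ℕ → V) (v : V) : Prop :=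
  ∀ f : StrongDual ℝ V, Tendsto (fun k => f (u k)) atTop (𝓝 (f v))

end FracVar

end

noncomputable section

namespace FracVar

/-! ### Elementary inequalities -/

/-! Absorb the kernel into the measure μ = K dx dy and put D u(x, y) = u(x) - u(y), so that Φ(u) = ∫
P(D u) dμ with P strictly convex and P' = a of growth q - 1. The kernel bounds make ∫ |D u|^q dμ
comparable to the Gagliardo modular, and since the exponent is bounded, this modular tends to zero
exactly when the norm does (`isModularMap_diff`). The rest is an argument about convex integral
functionals that uses neither compactness nor reflexivity.

Let `form` u be the functional v ↦ ∫ a(D u) D v dμ. Convexity gives `form` u (v - u) ≤ Φ(v) - Φ(u)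
(`form_sub_le`). Weak lower semicontinuity follows at once. This inequality, used at both u and v,
also squeezes the Taylor remainder between 0 and (`form` v - `form` u)(v - u), so the C¹ property
reduces to norm continuity of `form`. That comes from Young's inequality with ε and convergence of
a(D u_k) to a(D u) in the conjugate modular (`tendsto_conj`).

For (S₊), the hypotheses force the nonnegative functions F_k = (a(D u_k) - a(D v))(D u_k - D v) to
tend to zero in mean. Along subsequences F_k → 0 a.e., hence D u_k → D v a.e. by strict monotonicity
of a. The pointwise bound |D u_k - D v|^q ≤ B (F_k + |D v|^q) of `exists_abs_sub_rpow_le` then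
permits dominated convergence with a moving majorant (`tendsto_integral_zero_of_le_add`). -/

theorem rpow_sub_one_mul_self {a q : ℝ} (ha : 0 ≤ a) (hq : 1 < q) : a ^ (q - 1) * a = a ^ q := by
  rw [← Real.rpow_add_one' ha (by linarith), sub_add_cancel]

theorem rpow_sub_one_mul_le {a b q : ℝ} (ha : 0 ≤ a) (hb : 0 ≤ b) (hq : 1 < q) :
    a ^ (q - 1) * b ≤ a ^ q + b ^ q := by
  have h1 : 0 ≤ a ^ q := Real.rpow_nonneg ha q
  have h2 : 0 ≤ b ^ q := Real.rpow_nonneg hb q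
  rcases le_total b a with h | h
  · have : a ^ (q - 1) * b ≤ a ^ (q - 1) * a := by gcongr
    rw [rpow_sub_one_mul_self ha hq] at this
    linarith
  · have : a ^ (q - 1) * b ≤ b ^ (q - 1) * b :=
      mul_le_mul_of_nonneg_right (Real.rpow_le_rpow ha h (by linarith)) hb
    rw [rpow_sub_one_mul_self hb hq] at this
    linarith

theorem add_rpow_le_two_rpow {a b q M : ℝ} (ha : 0 ≤ a) (hb : 0 ≤ b) (hq : 1 < q) (hM : q ≤ M) :
    (a + b) ^ q ≤ 2 ^ M * (a ^ q + b ^ q) := by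
  have key : ∀ {a b : ℝ}, 0 ≤ a → 0 ≤ b → a ≤ b → (a + b) ^ q ≤ 2 ^ M * (a ^ q + b ^ q) := by
    intro a b ha hb h
    have h1 : 0 ≤ a ^ q := Real.rpow_nonneg ha q
    calc (a + b) ^ q ≤ (2 * b) ^ q := Real.rpow_le_rpow (by positivity) (by linarith) (by linarith)
      _ = 2 ^ q * b ^ q := Real.mul_rpow (by norm_num) hb
      _ ≤ 2 ^ M * b ^ q := by
        gcongr
        norm_num
      _ ≤ 2 ^ M * (a ^ q + b ^ q) := by
        gcongr
        linarith
  rcases le_total a b with h | h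
  · exact key ha hb h
  · rw [add_comm a b, add_comm (a ^ q)]
    exact key hb ha h

/-- Young's inequality with ε, where 1 + (q - 1)⁻¹ is the exponent conjugate to q. Compare a with ε
b^(q-1): below it the first term suffices, above it solve for b. The constant depends on m and not
on q, so the bound can be integrated with a variable exponent. -/
theorem mul_le_rpow_add {a b ε q m : ℝ} (ha : 0 ≤ a) (hb : 0 ≤ b) (hε : 0 < ε) (hε1 : ε ≤ 1)
    (hm : 1 < m) (hq : m ≤ q) :
    a * b ≤ ε * b ^ q + ε⁻¹ ^ (m - 1)⁻¹ * a ^ (1 + (q - 1)⁻¹) := by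
  have hq1 : 0 < q - 1 := by linarith
  have h1 : 0 ≤ b ^ q := Real.rpow_nonneg hb q
  have h2 : 0 ≤ a ^ (1 + (q - 1)⁻¹) := Real.rpow_nonneg ha _
  rcases le_total a (ε * b ^ (q - 1)) with h | h
  · have : a * b ≤ ε * b ^ (q - 1) * b := by gcongr
    rw [mul_assoc, rpow_sub_one_mul_self hb (by linarith)] at this
    have : 0 ≤ ε⁻¹ ^ (m - 1)⁻¹ * a ^ (1 + (q - 1)⁻¹) := by positivity
    linarith
  · have h3 : b ≤ ε⁻¹ ^ (q - 1)⁻¹ * a ^ (q - 1)⁻¹ := by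
      have h4 : b ^ (q - 1) ≤ ε⁻¹ * a := by
        rw [inv_mul_eq_div, le_div_iff₀' hε]
        exact h
      have := Real.rpow_le_rpow (by positivity) h4 (inv_nonneg.2 hq1.le)
      rwa [← Real.rpow_mul hb, mul_inv_cancel₀ hq1.ne', Real.rpow_one,
        Real.mul_rpow (by positivity) ha] at this
    have h5 : ε⁻¹ ^ (q - 1)⁻¹ ≤ ε⁻¹ ^ (m - 1)⁻¹ :=
      Real.rpow_le_rpow_of_exponent_le ((one_le_inv₀ hε).2 hε1)
        (inv_anti₀ (by linarith) (by linarith))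
    have h6 : a ^ (1 + (q - 1)⁻¹) = a * a ^ (q - 1)⁻¹ := by
      rw [Real.rpow_add' ha (by positivity), Real.rpow_one]
    calc a * b ≤ a * (ε⁻¹ ^ (m - 1)⁻¹ * a ^ (q - 1)⁻¹) := by
          refine mul_le_mul_of_nonneg_left (h3.trans ?_) ha
          gcongr
      _ = ε⁻¹ ^ (m - 1)⁻¹ * a ^ (1 + (q - 1)⁻¹) := by rw [h6]; ring
      _ ≤ _ := by
        have : 0 ≤ ε * b ^ q := by positivity
        linarith

/-- The conjugate exponent turns growth q - 1 into growth q, as (q - 1)(1 + (q - 1)⁻¹) = q. The `max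
1` makes the constant monotone in the exponent, hence uniform for m ≤ q ≤ M. -/
theorem abs_sub_rpow_conj_le {x y s t C q m M : ℝ} (hC : 0 < C) (hm : 1 < m) (hq : m ≤ q)
    (hM : q ≤ M) (hx : |x| ≤ C * |s| ^ (q - 1)) (hy : |y| ≤ C * |t| ^ (q - 1)) :
    |x - y| ^ (1 + (q - 1)⁻¹) ≤
      max 1 (2 * C) ^ (1 + (m - 1)⁻¹) * 2 ^ M * (|s - t| ^ q + |t| ^ q) := by
  have hq1 : 0 < q - 1 := by linarith
  set r := |s - t| + |t| with hr
  have hr0 : 0 ≤ r := by positivity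
  have hs : |s| ≤ r := by simpa using abs_add_le (s - t) t
  have ht : |t| ≤ r := by simp [hr]
  have h1 : |x - y| ≤ 2 * C * r ^ (q - 1) := by
    have h2 : |s| ^ (q - 1) ≤ r ^ (q - 1) := by gcongr
    have h3 : |t| ^ (q - 1) ≤ r ^ (q - 1) := by gcongr
    have h4 := mul_le_mul_of_nonneg_left h2 hC.le
    have h5 := mul_le_mul_of_nonneg_left h3 hC.le
    linarith [abs_sub x y]
  have hθ : 0 ≤ 1 + (q - 1)⁻¹ := by positivity
  calc |x - y| ^ (1 + (q - 1)⁻¹) ≤ (2 * C * r ^ (q - 1)) ^ (1 + (q - 1)⁻¹) := by gcongr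
    _ = (2 * C) ^ (1 + (q - 1)⁻¹) * r ^ q := by
      rw [Real.mul_rpow (by positivity) (by positivity), ← Real.rpow_mul hr0]
      congr 2
      field_simp
      ring
    _ ≤ max 1 (2 * C) ^ (1 + (m - 1)⁻¹) * (2 ^ M * (|s - t| ^ q + |t| ^ q)) := by
      refine mul_le_mul ?_ (add_rpow_le_two_rpow (abs_nonneg _) (abs_nonneg _) (by linarith) hM)
        (by positivity) (by positivity)
      refine (Real.rpow_le_rpow (by positivity) (le_max_right 1 _) hθ).trans ?_
      refine Real.rpow_le_rpow_of_exponent_le (le_max_left _ _) ?_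
      have := inv_anti₀ (show 0 < m - 1 by linarith) (show m - 1 ≤ q - 1 by linarith)
      linarith
    _ = _ := by ring

/-- The majorant needed for (S₊). If |s| ≤ R|t|, then |t|^q controls everything. If |s| ≥ R|t|, the
cross terms x t and y s are each at most (c/4)|s|^q, so coercivity leaves (x - y)(s - t) ≥
(c/2)|s|^q. -/
theorem exists_abs_sub_rpow_le {c C m M : ℝ} (hc : 0 < c) (hm : 1 < m) :
    ∃ B : ℝ, 0 ≤ B ∧ ∀ q x y s t : ℝ, m ≤ q → q ≤ M → c * |s| ^ q ≤ x * s → c * |t| ^ q ≤ y * t →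
      |x| ≤ C * |s| ^ (q - 1) → |y| ≤ C * |t| ^ (q - 1) → 0 ≤ (x - y) * (s - t) →
      |s - t| ^ q ≤ B * ((x - y) * (s - t) + |t| ^ q) := by
  -- The bound 4C/c ≤ R absorbs x t and 4C/c ≤ R^(m-1) absorbs y s; the latter can be met because m
  -- > 1. R ≥ 1 lets R^(m-1) be replaced by R^(q-1).
  obtain ⟨R, hR1, hR2, hR3⟩ : ∃ R : ℝ, 1 ≤ R ∧ 4 * C / c ≤ R ∧ 4 * C / c ≤ R ^ (m - 1) :=
    ((eventually_ge_atTop 1).and ((eventually_ge_atTop _).and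
      ((tendsto_rpow_atTop (by linarith : 0 < m - 1)).eventually_ge_atTop _))).exists
  have hR0 : 0 < R := by linarith
  refine ⟨2 ^ M * (2 / c + R ^ M + 1), by positivity, ?_⟩
  intro q x y s t hq hM hxs hyt hx hy hF
  have hq1 : 1 < q := by linarith
  have hs0 := abs_nonneg s
  have ht0 := abs_nonneg t
  have htq : 0 ≤ |t| ^ q := by positivity
  have hsq : 0 ≤ |s| ^ q := by positivity
  have key : |s| ^ q ≤ 2 / c * ((x - y) * (s - t)) + R ^ M * |t| ^ q := by
    rcases le_total |s| (R * |t|) with h | h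
    · have h1 : |s| ^ q ≤ R ^ M * |t| ^ q := by
        calc |s| ^ q ≤ (R * |t|) ^ q := by gcongr
          _ = R ^ q * |t| ^ q := Real.mul_rpow hR0.le ht0
          _ ≤ _ := by gcongr
      have : 0 ≤ 2 / c * ((x - y) * (s - t)) := by positivity
      linarith
    · have h1 : |x * t| ≤ c / 4 * |s| ^ q := by
        rw [abs_mul, ← rpow_sub_one_mul_self hs0 hq1]
        have h2 : C * |t| ≤ c / 4 * |s| := by
          have : 4 * C / c * |t| ≤ |s| := le_trans (by gcongr) h
          rw [div_mul_eq_mul_div, div_le_iff₀ hc] at this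
          linarith
        calc |x| * |t| ≤ C * |s| ^ (q - 1) * |t| := by gcongr
          _ = |s| ^ (q - 1) * (C * |t|) := by ring
          _ ≤ |s| ^ (q - 1) * (c / 4 * |s|) := by gcongr
          _ = _ := by ring
      have h3 : |y * s| ≤ c / 4 * |s| ^ q := by
        rw [abs_mul, ← rpow_sub_one_mul_self hs0 hq1]
        have h2 : C * |t| ^ (q - 1) ≤ c / 4 * |s| ^ (q - 1) := by
          have h4 : (R * |t|) ^ (q - 1) ≤ |s| ^ (q - 1) :=
            Real.rpow_le_rpow (by positivity) h (by linarith)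
          rw [Real.mul_rpow hR0.le ht0] at h4
          have h5 : R ^ (m - 1) ≤ R ^ (q - 1) :=
            Real.rpow_le_rpow_of_exponent_le hR1 (by linarith)
          have : 4 * C / c * |t| ^ (q - 1) ≤ |s| ^ (q - 1) :=
            le_trans (mul_le_mul_of_nonneg_right (hR3.trans h5) (by positivity)) h4
          rw [div_mul_eq_mul_div, div_le_iff₀ hc] at this
          linarith
        calc |y| * |s| ≤ C * |t| ^ (q - 1) * |s| := by gcongr
          _ ≤ c / 4 * |s| ^ (q - 1) * |s| := by gcongr
          _ = _ := by ring
      have h6 : c / 2 * |s| ^ q ≤ (x - y) * (s - t) := by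
        have e : (x - y) * (s - t) = x * s + y * t - x * t - y * s := by ring
        have : 0 ≤ c * |t| ^ q := by positivity
        rw [e]
        linarith [le_abs_self (x * t), le_abs_self (y * s)]
      have h7 : |s| ^ q ≤ 2 / c * ((x - y) * (s - t)) := by
        rw [div_mul_eq_mul_div, le_div_iff₀ hc]
        linarith
      have : 0 ≤ R ^ M * |t| ^ q := by positivity
      linarith
  have h1 : |s - t| ^ q ≤ 2 ^ M * (|s| ^ q + |t| ^ q) :=
    (Real.rpow_le_rpow (abs_nonneg _) (abs_sub s t) (by linarith)).trans
      (add_rpow_le_two_rpow hs0 ht0 hq1 hM)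
  refine h1.trans ?_
  rw [mul_assoc]
  refine mul_le_mul_of_nonneg_left ?_ (by positivity)
  have h2 : 0 ≤ (R ^ M + 1) * ((x - y) * (s - t)) := by positivity
  have h3 : 0 ≤ 2 / c * |t| ^ q := by positivity
  nlinarith

/-- If |t_k - τ| ≥ ε, monotonicity bounds the product below by ε times the smaller increment of a
over [τ - ε, τ] and [τ, τ + ε], which is positive. The same bound excludes escape to infinity. -/
theorem tendsto_of_monotone_mul_sub {a : ℝ → ℝ} (ha : StrictMono a) {t : ℕ → ℝ} {τ : ℝ}
    (h : Tendsto (fun k => (a (t k) - a τ) * (t k - τ)) atTop (𝓝 0)) :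
    Tendsto t atTop (𝓝 τ) := by
  rw [Metric.tendsto_atTop']
  intro ε hε
  have h1 : 0 < a (τ + ε) - a τ := sub_pos.2 (ha (by linarith))
  have h2 : 0 < a τ - a (τ - ε) := sub_pos.2 (ha (by linarith))
  have hev := h.eventually_lt_const (mul_pos (lt_min h1 h2) hε)
  obtain ⟨n, hn⟩ := eventually_atTop.1 hev
  refine ⟨n, fun k hk => ?_⟩
  have h3 := hn k hk.le
  by_contra hd
  rw [Real.dist_eq, not_lt, le_abs] at hd
  rcases hd with hd | hd
  · have h4 : a (τ + ε) ≤ a (t k) := ha.monotone (by linarith)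
    have h5 := mul_le_mul (show min (a (τ + ε) - a τ) (a τ - a (τ - ε)) ≤ a (t k) - a τ from
      (min_le_left _ _).trans (by linarith)) hd hε.le (by linarith)
    linarith
  · have h4 : a (t k) ≤ a (τ - ε) := ha.monotone (by linarith)
    have h5 := mul_le_mul (show min (a (τ + ε) - a τ) (a τ - a (τ - ε)) ≤ a τ - a (t k) from
      (min_le_right _ _).trans (by linarith)) hd hε.le (by linarith)
    linarith

theorem strictMono_of_strictConvexOn {f a : ℝ → ℝ} (hf : StrictConvexOn ℝ Set.univ f)
    (ha : ∀ t, HasDerivAt f (a t) t) : StrictMono a := by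
  have h := hf.strictMonoOn_deriv fun t _ => (ha t).differentiableAt
  rw [show deriv f = a from funext fun t => (ha t).deriv] at h
  exact strictMonoOn_univ.1 h

theorem mul_sub_le_of_convexOn {f : ℝ → ℝ} {a s t : ℝ} (hf : ConvexOn ℝ Set.univ f)
    (ha : HasDerivAt f a t) : a * (s - t) ≤ f s - f t := by
  rcases lt_trichotomy s t with h | h | h
  · have h1 := hf.slope_le_of_hasDerivAt (Set.mem_univ s) (Set.mem_univ t) h ha
    rw [slope_def_field, div_le_iff₀ (by linarith)] at h1
    linarith
  · simp [h]
  · have h1 := hf.le_slope_of_hasDerivAt (Set.mem_univ t) (Set.mem_univ s) h ha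
    rwa [slope_def_field, le_div_iff₀ (by linarith)] at h1

/-! ### A dominated convergence theorem -/

theorem exists_subseq_tendsto_ae_zero {X : Type*} [MeasurableSpace X] {μ : Measure X}
    {F : ℕ → X → ℝ} (hF : ∀ k, Integrable (F k) μ) (hF0 : ∀ k x, 0 ≤ F k x)
    (h : Tendsto (fun k => ∫ x, F k x ∂μ) atTop (𝓝 0)) :
    ∃ ns : ℕ → ℕ, StrictMono ns ∧ ∀ᵐ x ∂μ, Tendsto (fun k => F (ns k) x) atTop (𝓝 0) := by
  have h1 : TendstoInMeasure μ F atTop fun _ => (0 : ℝ) := by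
    refine tendstoInMeasure_of_tendsto_eLpNorm one_ne_zero (fun k => (hF k).aestronglyMeasurable)
      aestronglyMeasurable_const ?_
    have h2 : ∀ k, eLpNorm (F k - fun _ => (0 : ℝ)) 1 μ = ENNReal.ofReal (∫ x, F k x ∂μ) := by
      intro k
      rw [show (F k - fun _ => (0 : ℝ)) = F k from sub_zero _, eLpNorm_one_eq_lintegral_enorm,
        ofReal_integral_eq_lintegral_ofReal (hF k) (ae_of_all _ (hF0 k))]
      exact lintegral_congr fun x => Real.enorm_of_nonneg (hF0 k x)
    simp_rw [h2]
    simpa using ENNReal.tendsto_ofReal h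
  exact h1.exists_seq_tendsto_ae

/-- Dominated convergence with a convergent majorant, along a sequence that converges to zero
only in the mean. -/
theorem tendsto_integral_zero_of_le_add {X : Type*} [MeasurableSpace X] {μ : Measure X}
    {F G : ℕ → X → ℝ} {g : X → ℝ} {B : ℝ} (hF : ∀ k, Integrable (F k) μ)
    (hF0 : ∀ k x, 0 ≤ F k x) (hG : ∀ k, AEStronglyMeasurable (G k) μ) (hG0 : ∀ k x, 0 ≤ G k x)
    (hg : Integrable g μ) (hg0 : ∀ x, 0 ≤ g x) (hB : 0 ≤ B)
    (hle : ∀ k, ∀ᵐ x ∂μ, G k x ≤ B * (F k x + g x))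
    (hsub : ∀ᵐ x ∂μ, ∀ ns : ℕ → ℕ, Tendsto (fun k => F (ns k) x) atTop (𝓝 0) →
      Tendsto (fun k => G (ns k) x) atTop (𝓝 0))
    (h : Tendsto (fun k => ∫ x, F k x ∂μ) atTop (𝓝 0)) :
    Tendsto (fun k => ∫ x, G k x ∂μ) atTop (𝓝 0) := by
  -- A further subsequence on which F → 0 a.e. suffices. The null set in `hsub` is independent of
  -- the subsequence, so it can be fixed beforehand.
  refine tendsto_of_subseq_tendsto fun ns hns => ?_
  obtain ⟨ms, hms, hae⟩ := exists_subseq_tendsto_ae_zero (fun k => hF (ns k))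
    (fun k => hF0 (ns k)) (h.comp hns)
  refine ⟨ms, ?_⟩
  set φ : ℕ → ℕ := fun k => ns (ms k) with hφ
  have hFφ : Tendsto (fun k => ∫ x, F (φ k) x ∂μ) atTop (𝓝 0) :=
    h.comp (hns.comp hms.tendsto_atTop)
  -- Only the excess of G over B F needs domination: its positive part is at most B g. The part B F
  -- has vanishing integral anyway.
  have h1 : Tendsto (fun k => ∫ x, max (G (φ k) x - B * F (φ k) x) 0 ∂μ) atTop
      (𝓝 (∫ _, (0 : ℝ) ∂μ)) := by
    refine tendsto_integral_of_dominated_convergence (fun x => B * g x) (fun k => ?_)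
      (hg.const_mul B) (fun k => ?_) ?_
    · exact ((hG _).sub ((hF _).aestronglyMeasurable.const_mul B)).sup aestronglyMeasurable_const
    · filter_upwards [hle (φ k)] with x hx
      rw [Real.norm_of_nonneg (le_max_right _ _)]
      exact max_le (by linarith) (mul_nonneg hB (hg0 x))
    · filter_upwards [hae, hsub] with x hx hx'
      have := ((hx' φ hx).sub (hx.const_mul B)).max (tendsto_const_nhds (x := (0 : ℝ)))
      simpa using this
  rw [integral_zero] at h1
  have h2 := h1.add (hFφ.const_mul B)
  rw [mul_zero, add_zero] at h2
  refine squeeze_zero (fun k => integral_nonneg (hG0 _)) (fun k => ?_) h2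
  have hGi : Integrable (G (φ k)) μ := by
    refine (((hF (φ k)).add hg).const_mul B).mono' (hG _) ?_
    filter_upwards [hle (φ k)] with x hx
    rw [Real.norm_of_nonneg (hG0 _ _)]
    exact hx
  have hmax : Integrable (fun x => max (G (φ k) x - B * F (φ k) x) 0) μ :=
    (hGi.sub ((hF _).const_mul B)).sup (integrable_zero _ _ _)
  rw [← integral_const_mul, ← integral_add hmax ((hF _).const_mul B)]
  refine integral_mono hGi (hmax.add ((hF _).const_mul B)) fun x => ?_
  have := le_max_left (G (φ k) x - B * F (φ k) x) 0
  simp only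
  linarith

/-! ### Convex integral functionals of a linear map into a modular space -/

section Abstract

variable {X V : Type*} [MeasurableSpace X] [NormedAddCommGroup V] [NormedSpace ℝ V]

/-- A map `D` from `V` to the measurable functions on `X`, linear modulo equality almost
everywhere, such that the modular `∫ |D u|^q dμ` is finite and induces the topology of `V`. -/
structure IsModularMap (μ : Measure X) (q : X → ℝ) (D : V → X → ℝ) : Prop where
  measurable : ∀ u, Measurable (D u)
  add : ∀ u v, ∀ᵐ x ∂μ, D (u + v) x = D u x + D v x
  smul : ∀ (c : ℝ) u, ∀ᵐ x ∂μ, D (c • u) x = c * D u x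
  integrable : ∀ u, Integrable (fun x => |D u x| ^ q x) μ
  bounded : ∃ M, ∀ u, ‖u‖ ≤ 1 → ∫ x, |D u x| ^ q x ∂μ ≤ M
  tendsto_zero_iff : ∀ u : ℕ → V,
    Tendsto u atTop (𝓝 0) ↔ Tendsto (fun k => ∫ x, |D (u k) x| ^ q x ∂μ) atTop (𝓝 0)

/-- A nonlinearity `a` of growth `q - 1` with strictly convex primitive `P`; the exponent is
bounded and bounded away from `1`. -/
structure IsPotential (q : X → ℝ) (a P : X → ℝ → ℝ) (m M c C : ℝ) : Prop where
  measurable_exp : Measurable q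
  one_lt : 1 < m
  le_exp : ∀ x, m ≤ q x
  exp_le : ∀ x, q x ≤ M
  measurable : Measurable (Function.uncurry a)
  continuous : ∀ x, Continuous (a x)
  measurable_prim : Measurable (Function.uncurry P)
  hasDerivAt : ∀ x t, HasDerivAt (P x) (a x t) t
  strictConvex : ∀ x, StrictConvexOn ℝ Set.univ (P x)
  c_pos : 0 < c
  C_pos : 0 < C
  coercive : ∀ x t, c * |t| ^ q x ≤ a x t * t
  growth : ∀ x t, |a x t| ≤ C * |t| ^ (q x - 1)
  prim_le : ∀ x t, |P x t| ≤ C * |t| ^ q x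

variable {μ : Measure X} {q : X → ℝ} {D : V → X → ℝ} {a P : X → ℝ → ℝ} {m M c C : ℝ}

namespace IsModularMap

theorem sub (hD : IsModularMap μ q D) (u v : V) : ∀ᵐ x ∂μ, D (u - v) x = D u x - D v x := by
  filter_upwards [hD.add (u - v) v] with x hx
  rw [sub_add_cancel] at hx
  linarith

end IsModularMap

namespace IsPotential

theorem one_lt_exp (ha : IsPotential q a P m M c C) (x : X) : 1 < q x :=
  ha.one_lt.trans_le (ha.le_exp x)

theorem measurable_comp (ha : IsPotential q a P m M c C) {f : X → ℝ} (hf : Measurable f) :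
    Measurable fun x => a x (f x) :=
  ha.measurable.comp (measurable_id.prodMk hf)

theorem strictMono (ha : IsPotential q a P m M c C) (x : X) : StrictMono (a x) :=
  strictMono_of_strictConvexOn (ha.strictConvex x) (ha.hasDerivAt x)

theorem mul_sub_le (ha : IsPotential q a P m M c C) (x : X) (s t : ℝ) :
    a x t * (s - t) ≤ P x s - P x t :=
  mul_sub_le_of_convexOn (ha.strictConvex x).convexOn (ha.hasDerivAt x t)

theorem monotone_mul (ha : IsPotential q a P m M c C) (x : X) (s t : ℝ) :
    0 ≤ (a x s - a x t) * (s - t) := by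
  rcases le_total s t with h | h
  · exact mul_nonneg_of_nonpos_of_nonpos (sub_nonpos.2 ((ha.strictMono x).monotone h))
      (sub_nonpos.2 h)
  · exact mul_nonneg (sub_nonneg.2 ((ha.strictMono x).monotone h)) (sub_nonneg.2 h)

theorem abs_mul_le (ha : IsPotential q a P m M c C) (x : X) (s t : ℝ) :
    |a x s * t| ≤ C * (|s| ^ q x + |t| ^ q x) := by
  rw [abs_mul]
  calc |a x s| * |t| ≤ C * |s| ^ (q x - 1) * |t| := by
        gcongr
        exact ha.growth x s
    _ = C * (|s| ^ (q x - 1) * |t|) := by ring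
    _ ≤ _ := mul_le_mul_of_nonneg_left
      (rpow_sub_one_mul_le (abs_nonneg _) (abs_nonneg _) (ha.one_lt_exp x)) ha.C_pos.le

theorem integrable_prim (ha : IsPotential q a P m M c C) (hD : IsModularMap μ q D) (u : V) :
    Integrable (fun x => P x (D u x)) μ :=
  ((hD.integrable u).const_mul C).mono'
    (ha.measurable_prim.comp (measurable_id.prodMk (hD.measurable u))).aestronglyMeasurable
    (ae_of_all _ fun x => ha.prim_le x _)

theorem integrable_mul (ha : IsPotential q a P m M c C) (hD : IsModularMap μ q D) (u v : V) :
    Integrable (fun x => a x (D u x) * D v x) μ :=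
  (((hD.integrable u).add (hD.integrable v)).const_mul C).mono'
    ((ha.measurable_comp (hD.measurable u)).mul (hD.measurable v)).aestronglyMeasurable
    (ae_of_all _ fun x => ha.abs_mul_le x _ _)

/-- The linear form `v ↦ ∫ a(D u) D v dμ`. -/
def formLin (ha : IsPotential q a P m M c C) (hD : IsModularMap μ q D) (u : V) : V →ₗ[ℝ] ℝ where
  toFun v := ∫ x, a x (D u x) * D v x ∂μ
  map_add' v w := by
    rw [← integral_add (ha.integrable_mul hD u v) (ha.integrable_mul hD u w)]
    refine integral_congr_ae ?_
    filter_upwards [hD.add v w] with x hx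
    rw [hx, mul_add]
  map_smul' r v := by
    rw [RingHom.id_apply, smul_eq_mul, ← integral_const_mul]
    refine integral_congr_ae ?_
    filter_upwards [hD.smul r v] with x hx
    rw [hx, mul_left_comm]

theorem exists_bound_formLin (ha : IsPotential q a P m M c C) (hD : IsModularMap μ q D) (u : V) :
    ∃ B, ∀ v, ‖ha.formLin hD u v‖ ≤ B * ‖v‖ := by
  obtain ⟨R, hR⟩ := hD.bounded
  refine ⟨_, LinearMap.bound_of_ball_bound' one_pos
    (C * ((∫ x, |D u x| ^ q x ∂μ) + R)) (ha.formLin hD u) fun v hv => ?_⟩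
  calc ‖ha.formLin hD u v‖ ≤ ∫ x, ‖a x (D u x) * D v x‖ ∂μ := norm_integral_le_integral_norm _
    _ ≤ ∫ x, C * (|D u x| ^ q x + |D v x| ^ q x) ∂μ :=
      integral_mono (ha.integrable_mul hD u v).norm
        (((hD.integrable u).add (hD.integrable v)).const_mul C) fun x => ha.abs_mul_le x _ _
    _ = C * ((∫ x, |D u x| ^ q x ∂μ) + ∫ x, |D v x| ^ q x ∂μ) := by
      rw [integral_const_mul, integral_add (hD.integrable u) (hD.integrable v)]
    _ ≤ _ := by
      have := hR v (by simpa using hv)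
      have := ha.C_pos
      gcongr

/-- The continuous linear form `v ↦ ∫ a(D u) D v dμ`. -/
def form (ha : IsPotential q a P m M c C) (hD : IsModularMap μ q D) (u : V) : V →L[ℝ] ℝ :=
  (ha.formLin hD u).mkContinuousOfExistsBound (ha.exists_bound_formLin hD u)

theorem form_apply (ha : IsPotential q a P m M c C) (hD : IsModularMap μ q D) (u v : V) :
    ha.form hD u v = ∫ x, a x (D u x) * D v x ∂μ := rfl

/-- The supporting-line inequality for P, integrated. -/
theorem form_sub_le (ha : IsPotential q a P m M c C) (hD : IsModularMap μ q D) (u v : V) :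
    ha.form hD u (v - u) ≤ (∫ x, P x (D v x) ∂μ) - ∫ x, P x (D u x) ∂μ := by
  rw [form_apply, ← integral_sub (ha.integrable_prim hD v) (ha.integrable_prim hD u)]
  refine integral_mono_ae (ha.integrable_mul hD u _)
    ((ha.integrable_prim hD v).sub (ha.integrable_prim hD u)) ?_
  filter_upwards [hD.sub v u] with x hx
  rw [hx]
  exact ha.mul_sub_le x _ _

/-! ### Conjugate modular and continuity of the derivative -/

theorem measurable_conj (ha : IsPotential q a P m M c C) (hD : IsModularMap μ q D) (u v : V) :
    Measurable fun x => |a x (D u x) - a x (D v x)| ^ (1 + (q x - 1)⁻¹) := by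
  have h1 := ha.measurable_comp (hD.measurable u)
  have h2 := ha.measurable_comp (hD.measurable v)
  have h3 := ha.measurable_exp
  have h4 : Measurable fun x => |a x (D u x) - a x (D v x)| := (h1.sub h2).norm
  exact h4.pow (measurable_const.add (h3.sub measurable_const).inv)

theorem exists_conj_le (ha : IsPotential q a P m M c C) (hD : IsModularMap μ q D) :
    ∃ B, 0 ≤ B ∧ ∀ u v : V, ∀ᵐ x ∂μ, |a x (D u x) - a x (D v x)| ^ (1 + (q x - 1)⁻¹) ≤
      B * (|D (u - v) x| ^ q x + |D v x| ^ q x) := by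
  refine ⟨max 1 (2 * C) ^ (1 + (m - 1)⁻¹) * 2 ^ M, by positivity, fun u v => ?_⟩
  filter_upwards [hD.sub u v] with x hx
  rw [hx]
  exact abs_sub_rpow_conj_le ha.C_pos ha.one_lt (ha.le_exp x) (ha.exp_le x) (ha.growth x _)
    (ha.growth x _)

theorem integrable_conj (ha : IsPotential q a P m M c C) (hD : IsModularMap μ q D) (u v : V) :
    Integrable (fun x => |a x (D u x) - a x (D v x)| ^ (1 + (q x - 1)⁻¹)) μ := by
  obtain ⟨B, -, hB⟩ := ha.exists_conj_le hD
  refine (((hD.integrable (u - v)).add (hD.integrable v)).const_mul B).mono'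
    (ha.measurable_conj hD u v).aestronglyMeasurable ?_
  filter_upwards [hB u v] with x hx
  rwa [Real.norm_of_nonneg (by positivity)]

/-- Continuity of the superposition operator u ↦ a(D u) into the conjugate modular space. The moving
part |D(u_k - v)|^q of the majorant tends to zero in mean; its pointwise convergence along
subsequences passes through continuity of a. -/
theorem tendsto_conj (ha : IsPotential q a P m M c C) (hD : IsModularMap μ q D) {u : ℕ → V}
    {v : V} (h : Tendsto u atTop (𝓝 v)) :
    Tendsto (fun k => ∫ x, |a x (D (u k) x) - a x (D v x)| ^ (1 + (q x - 1)⁻¹) ∂μ) atTop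
      (𝓝 0) := by
  obtain ⟨B, hB0, hB⟩ := ha.exists_conj_le hD
  have h0 : Tendsto (fun k => u k - v) atTop (𝓝 0) := by
    simpa using h.sub_const v
  refine tendsto_integral_zero_of_le_add (F := fun k x => |D (u k - v) x| ^ q x)
    (g := fun x => |D v x| ^ q x) (fun k => hD.integrable _)
    (fun k x => by positivity) (fun k => (ha.measurable_conj hD _ _).aestronglyMeasurable)
    (fun k x => by positivity) (hD.integrable v) (fun x => by positivity) hB0
    (fun k => hB (u k) v) ?_ ((hD.tendsto_zero_iff _).1 h0)
  filter_upwards [ae_all_iff.2 fun k => hD.sub (u k) v] with x hx ns hns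
  have hq : 0 < q x := one_pos.trans (ha.one_lt_exp x)
  have hq1 : 0 < q x - 1 := sub_pos.2 (ha.one_lt_exp x)
  simp only [hx] at hns
  have h1 : Tendsto (fun k => D (u (ns k)) x - D v x) atTop (𝓝 0) := by
    have := hns.rpow_const (p := (q x)⁻¹) (Or.inr (by positivity))
    rw [Real.zero_rpow (by positivity)] at this
    rw [tendsto_zero_iff_abs_tendsto_zero]
    refine this.congr fun k => ?_
    rw [← Real.rpow_mul (abs_nonneg _), mul_inv_cancel₀ hq.ne', Real.rpow_one]
    rfl
  have h2 : Tendsto (fun k => D (u (ns k)) x) atTop (𝓝 (D v x)) := by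
    simpa using h1.add_const (D v x)
  have h3 := (((ha.continuous x).tendsto _).comp h2).sub_const (a x (D v x))
  rw [sub_self] at h3
  have h4 := h3.abs.rpow_const (p := 1 + (q x - 1)⁻¹) (Or.inr (by positivity))
  rwa [abs_zero, Real.zero_rpow (by positivity)] at h4

/-- Young's inequality replaces Hölder's: on the unit sphere the difference of forms is at most ε R
plus a constant depending on ε times the conjugate modular, where R bounds the modular on the unit
ball. Fix ε first, then let k grow. -/
theorem continuous_form (ha : IsPotential q a P m M c C) (hD : IsModularMap μ q D) :
    Continuous (ha.form hD) := by
  rw [continuous_iff_seqContinuous]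
  intro u v hu
  rw [tendsto_iff_norm_sub_tendsto_zero]
  obtain ⟨R, hR⟩ := hD.bounded
  have hR0 : 0 ≤ R :=
    (integral_nonneg fun x => by positivity).trans (hR 0 (by simp))
  have key : ∀ ε : ℝ, 0 < ε → ε ≤ 1 → ∀ k, ‖ha.form hD (u k) - ha.form hD v‖ ≤
      ε * R + ε⁻¹ ^ (m - 1)⁻¹ *
        ∫ x, |a x (D (u k) x) - a x (D v x)| ^ (1 + (q x - 1)⁻¹) ∂μ := by
    intro ε hε hε1 k
    have hI : 0 ≤ ∫ x, |a x (D (u k) x) - a x (D v x)| ^ (1 + (q x - 1)⁻¹) ∂μ :=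
      integral_nonneg fun x => by positivity
    refine ContinuousLinearMap.opNorm_le_of_unit_norm (by positivity) fun w hw => ?_
    rw [sub_apply, form_apply, form_apply,
      ← integral_sub (ha.integrable_mul hD _ w) (ha.integrable_mul hD _ w)]
    refine (norm_integral_le_of_norm_le (((hD.integrable w).const_mul ε).add
      ((ha.integrable_conj hD (u k) v).const_mul (ε⁻¹ ^ (m - 1)⁻¹))) (ae_of_all _ fun x => ?_)).trans
      ?_
    · rw [← sub_mul, norm_mul]
      exact mul_le_rpow_add (abs_nonneg _) (abs_nonneg _) hε hε1 ha.one_lt (ha.le_exp x)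
    · simp only [Pi.add_apply]
      rw [integral_add ((hD.integrable w).const_mul ε) ((ha.integrable_conj hD _ v).const_mul _),
        integral_const_mul, integral_const_mul]
      have := hR w hw.le
      gcongr
  rw [Metric.tendsto_atTop']
  intro δ hδ
  -- R may be zero, hence R + 1 in the denominator; the cap 1 is required by `mul_le_rpow_add`.
  set ε : ℝ := min 1 (δ / (2 * (R + 1))) with hε
  have hε0 : 0 < ε := by positivity
  have hεR : ε * R < δ := by
    have h1 : ε ≤ δ / (2 * (R + 1)) := min_le_right _ _
    rw [le_div_iff₀ (by positivity)] at h1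
    nlinarith
  have h1 := ((ha.tendsto_conj hD hu).const_mul (ε⁻¹ ^ (m - 1)⁻¹)).const_add (ε * R)
  rw [mul_zero, add_zero] at h1
  obtain ⟨n, hn⟩ := eventually_atTop.1 (h1.eventually_lt_const hεR)
  refine ⟨n, fun k hk => ?_⟩
  rw [dist_zero_right, norm_norm]
  exact (key ε hε0 (min_le_left _ _) k).trans_lt (hn k hk.le)

/-- Convexity at u makes the remainder nonnegative, and convexity at v bounds it by (`form` v -
`form` u)(v - u), which is o(‖v - u‖) by continuity of `form`. -/
theorem hasFDerivAt_integral (ha : IsPotential q a P m M c C) (hD : IsModularMap μ q D) (u : V) :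
    HasFDerivAt (fun v => ∫ x, P x (D v x) ∂μ) (ha.form hD u) u := by
  refine HasFDerivAt.of_isLittleO ?_
  rw [Asymptotics.isLittleO_iff]
  intro ε hε
  have h1 := ((ha.continuous_form hD).tendsto u).eventually (Metric.ball_mem_nhds _ hε)
  filter_upwards [h1] with v hv
  have h2 := ha.form_sub_le hD u v
  have h3 := ha.form_sub_le hD v u
  rw [← neg_sub v u, map_neg] at h3
  have h4 : ‖(ha.form hD v - ha.form hD u) (v - u)‖ ≤ ε * ‖v - u‖ := by
    refine (ContinuousLinearMap.le_opNorm _ _).trans ?_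
    gcongr
    exact (mem_ball_iff_norm.1 hv).le
  rw [sub_apply] at h4
  rw [Real.norm_of_nonneg (by linarith)]
  linarith [Real.le_norm_self (ha.form hD v (v - u) - ha.form hD u (v - u))]

theorem contDiff_integral (ha : IsPotential q a P m M c C) (hD : IsModularMap μ q D) :
    ContDiff ℝ 1 fun v => ∫ x, P x (D v x) ∂μ :=
  contDiff_one_iff_hasFDerivAt.2 ⟨ha.form hD, ha.continuous_form hD, ha.hasFDerivAt_integral hD⟩

/-- The tangent affine function at v lies below the functional and is weakly continuous. -/
theorem le_liminf_integral (ha : IsPotential q a P m M c C) (hD : IsModularMap μ q D)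
    {u : ℕ → V} {v : V} (h : WeakTendsto u v) :
    ((∫ x, P x (D v x) ∂μ : ℝ) : EReal) ≤
      liminf (fun k => ((∫ x, P x (D (u k) x) ∂μ : ℝ) : EReal)) atTop := by
  have h1 : Tendsto (fun k => (∫ x, P x (D v x) ∂μ) + ha.form hD v (u k - v)) atTop
      (𝓝 (∫ x, P x (D v x) ∂μ)) := by
    have := ((h (ha.form hD v)).sub_const (ha.form hD v v)).const_add (∫ x, P x (D v x) ∂μ)
    simpa only [sub_self, add_zero, map_sub] using this
  rw [← ((continuous_coe_real_ereal.tendsto _).comp h1).liminf_eq]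
  refine liminf_le_liminf (Eventually.of_forall fun k => ?_)
  simp only [Function.comp_apply]
  exact EReal.coe_le_coe_iff.2 (by linarith [ha.form_sub_le hD v (u k)])

theorem tendsto_of_limsup_form_le (ha : IsPotential q a P m M c C) (hD : IsModularMap μ q D)
    {u : ℕ → V} {v : V} (h : WeakTendsto u v)
    (hlim : limsup (fun k => (ha.form hD (u k) (u k - v) : EReal)) atTop ≤ 0) :
    Tendsto u atTop (𝓝 v) := by
  set F : ℕ → X → ℝ := fun k x => (a x (D (u k) x) - a x (D v x)) * (D (u k) x - D v x) with hF
  have hFeq : ∀ k, F k =ᵐ[μ] fun x =>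
      a x (D (u k) x) * D (u k - v) x - a x (D v x) * D (u k - v) x := by
    intro k
    filter_upwards [hD.sub (u k) v] with x hx
    rw [hx, ← sub_mul]
  have hFi : ∀ k, Integrable (F k) μ := fun k =>
    ((ha.integrable_mul hD _ _).sub (ha.integrable_mul hD _ _)).congr (hFeq k).symm
  have hF0 : ∀ k x, 0 ≤ F k x := fun k x => ha.monotone_mul x _ _
  have hFint : ∀ k, ∫ x, F k x ∂μ = ha.form hD (u k) (u k - v) - ha.form hD v (u k - v) := by
    intro k
    rw [integral_congr_ae (hFeq k),
      integral_sub (ha.integrable_mul hD _ _) (ha.integrable_mul hD _ _)]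
    rfl
  have hweak : Tendsto (fun k => ha.form hD v (u k - v)) atTop (𝓝 0) := by
    have := (h (ha.form hD v)).sub_const (ha.form hD v v)
    simpa only [sub_self, map_sub] using this
  -- The limsup hypothesis bounds the term at u_k from above, weak convergence kills the term at v,
  -- and F ≥ 0 gives the lower bound.
  have hFlim : Tendsto (fun k => ∫ x, F k x ∂μ) atTop (𝓝 0) := by
    rw [Metric.tendsto_atTop']
    intro ε hε
    have h1 : ∀ᶠ k in atTop, (ha.form hD (u k) (u k - v) : EReal) < ((ε / 2 : ℝ) : EReal) :=
      eventually_lt_of_limsup_lt (hlim.trans_lt (by exact_mod_cast half_pos hε))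
    have h2 := hweak.eventually_const_lt (show -(ε / 2) < 0 by linarith)
    obtain ⟨n, hn⟩ := eventually_atTop.1 (h1.and h2)
    refine ⟨n, fun k hk => ?_⟩
    obtain ⟨h3, h4⟩ := hn k hk.le
    rw [dist_zero_right, Real.norm_of_nonneg (integral_nonneg (hF0 k)), hFint]
    have := EReal.coe_lt_coe_iff.1 h3
    linarith
  obtain ⟨B, hB0, hB⟩ := exists_abs_sub_rpow_le (C := C) (M := M) ha.c_pos ha.one_lt
  have hG : Tendsto (fun k => ∫ x, |D (u k - v) x| ^ q x ∂μ) atTop (𝓝 0) := by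
    refine tendsto_integral_zero_of_le_add (F := F) (g := fun x => |D v x| ^ q x) hFi hF0
      (fun k => (hD.integrable _).aestronglyMeasurable) (fun k x => by positivity)
      (hD.integrable v) (fun x => by positivity) hB0 (fun k => ?_) ?_ hFlim
    · filter_upwards [hD.sub (u k) v] with x hx
      rw [hx]
      exact hB _ _ _ _ _ (ha.le_exp x) (ha.exp_le x) (ha.coercive x _) (ha.coercive x _)
        (ha.growth x _) (ha.growth x _) (hF0 k x)
    · filter_upwards [ae_all_iff.2 fun k => hD.sub (u k) v] with x hx ns hns
      have hq : 0 < q x := one_pos.trans (ha.one_lt_exp x)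
      have h1 := (tendsto_of_monotone_mul_sub (ha.strictMono x) hns).sub_const (D v x)
      rw [sub_self] at h1
      have h2 := h1.abs.rpow_const (p := q x) (Or.inr hq.le)
      rw [abs_zero, Real.zero_rpow hq.ne'] at h2
      simpa only [hx] using h2
  have h0 := ((hD.tendsto_zero_iff _).2 hG).add_const v
  simpa using h0

end IsPotential

end Abstract

/-! ### The Gagliardo modular and the norm of `W` -/

section Gagliardo

variable {N : ℕ} {s : ℝ} {p : Eu N × Eu N → ℝ} {Ω : Set (Eu N)}

theorem Standing.le_expSup (h : Standing N s p Ω) (z : Eu N × Eu N) : p z ≤ expSup p :=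
  le_ciSup h.bddAbove z

theorem Standing.expInf_le (h : Standing N s p Ω) (z : Eu N × Eu N) : expInf p ≤ p z := by
  refine ciInf_le ⟨1, ?_⟩ z
  rintro _ ⟨y, rfl⟩
  exact (h.one_lt y).le

/-- A Δ₂ condition, due to the bounded exponent. It makes the modular finite on all of `W` and lets
a small modular force a small norm. -/
theorem gagModular_mul_le (h : Standing N s p Ω) (r : ℝ) (f : Eu N → ℝ) :
    gagModular s p (fun x => r * f x) ≤
      ENNReal.ofReal (max 1 |r| ^ expSup p) * gagModular s p f := by
  unfold gagModular
  rw [← lintegral_const_mul' _ _ ENNReal.ofReal_ne_top]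
  refine lintegral_mono fun z => ?_
  rw [← ENNReal.ofReal_mul (by positivity)]
  refine ENNReal.ofReal_le_ofReal ?_
  rw [← mul_div_assoc]
  refine div_le_div_of_nonneg_right ?_ (by positivity)
  have hp := h.one_lt z
  rw [← mul_sub, abs_mul, Real.mul_rpow (abs_nonneg _) (abs_nonneg _)]
  refine mul_le_mul_of_nonneg_right ?_ (by positivity)
  exact (Real.rpow_le_rpow (abs_nonneg _) (le_max_right 1 _) (by linarith)).trans
    (Real.rpow_le_rpow_of_exponent_le (le_max_left _ _) (h.le_expSup z))

namespace W

variable {h : Standing N s p Ω}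

theorem measurable_coe (u : W h) : Measurable u := u.toClass.stronglyMeasurable.measurable

theorem gagModular_le_of_div (u : W h) {ζ : ℝ} (hζ : 0 < ζ) :
    gagModular s p u ≤
      ENNReal.ofReal (max 1 ζ ^ expSup p) * gagModular s p (fun x => u x / ζ) := by
  have h1 := gagModular_mul_le h ζ fun x => u x / ζ
  simpa only [mul_div_cancel₀ _ hζ.ne', abs_of_pos hζ] using h1

theorem gagModular_lt_top (u : W h) : gagModular s p u < ∞ := by
  obtain ⟨ζ, hζ, hfin⟩ := u.memW.2.1
  exact (u.gagModular_le_of_div hζ).trans_lt (ENNReal.mul_lt_top ENNReal.ofReal_lt_top hfin)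

theorem exists_gagModular_div_le_one (u : W h) {r : ℝ} (hr : ‖u‖ < r) :
    ∃ ζ : ℝ, 0 < ζ ∧ ζ < r ∧ gagModular s p (fun x => u x / ζ) ≤ 1 := by
  have hne : {ζ : ℝ | 0 < ζ ∧ gagModular s p (fun x => u x / ζ) ≤ 1}.Nonempty := by
    have := (gagModular_isConvexModular h).exists_le_one u.memW.gag
    simpa only [gagModular_congr (coe_inv_smul _ u.toClass)] using this
  obtain ⟨ζ, ⟨h1, h2⟩, h3⟩ := exists_lt_of_csInf_lt hne hr
  exact ⟨ζ, h1, h3, h2⟩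

theorem gagModular_le_of_norm_le_one (u : W h) (hu : ‖u‖ ≤ 1) :
    gagModular s p u ≤ ENNReal.ofReal (2 ^ expSup p) := by
  obtain ⟨ζ, hζ, hζ2, h1⟩ := u.exists_gagModular_div_le_one (r := 2) (by linarith)
  have h0 : 0 ≤ expSup p := by
    have := h.one_lt 0
    linarith [h.le_expSup 0]
  calc gagModular s p u ≤ ENNReal.ofReal (max 1 ζ ^ expSup p) * 1 :=
        (u.gagModular_le_of_div hζ).trans (by gcongr)
    _ ≤ _ := by
      rw [mul_one]
      refine ENNReal.ofReal_le_ofReal (Real.rpow_le_rpow (by positivity) ?_ h0)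
      exact max_le one_le_two hζ2.le

/-- Convexity with ρ(0) = 0 gives ρ(u) ≤ ζ ρ(u/ζ) ≤ ζ for an admissible ζ < ε ≤ 1. -/
theorem gagModular_le_of_norm_lt (u : W h) {ε : ℝ} (hε : ε ≤ 1) (hu : ‖u‖ < ε) :
    gagModular s p u ≤ ENNReal.ofReal ε := by
  obtain ⟨ζ, hζ, hζε, h1⟩ := u.exists_gagModular_div_le_one hu
  have h2 := (gagModular_isConvexModular h).smul_le (ζ⁻¹ • u.toClass) hζ.le (hζε.le.trans hε)
  simp only [smul_smul, mul_inv_cancel₀ hζ.ne', one_smul,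
    gagModular_congr (coe_inv_smul ζ u.toClass)] at h2
  calc gagModular s p u ≤ ENNReal.ofReal ζ * 1 := h2.trans (by gcongr)
    _ ≤ _ := by
      rw [mul_one]
      exact ENNReal.ofReal_le_ofReal hζε.le

theorem norm_le_of_gagModular_le (u : W h) {ε : ℝ} (hε : 0 < ε)
    (hu : ENNReal.ofReal (max 1 ε⁻¹ ^ expSup p) * gagModular s p u ≤ 1) : ‖u‖ ≤ ε := by
  refine csInf_le ⟨0, fun _ hx => hx.1.le⟩ ⟨hε, ?_⟩
  have h1 := gagModular_mul_le h ε⁻¹ u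
  rw [abs_of_pos (inv_pos.2 hε)] at h1
  simp only [div_eq_inv_mul]
  exact h1.trans hu

theorem tendsto_zero_iff_gagModular (u : ℕ → W h) :
    Tendsto u atTop (𝓝 0) ↔ Tendsto (fun k => gagModular s p (u k)) atTop (𝓝 0) := by
  rw [tendsto_zero_iff_norm_tendsto_zero]
  refine ⟨fun hu => ?_, fun hu => ?_⟩
  · rw [ENNReal.tendsto_nhds_zero]
    intro ε hε
    obtain ⟨δ, hδ, hδε⟩ : ∃ δ : ℝ, 0 < δ ∧ ENNReal.ofReal δ ≤ ε := by
      obtain ⟨r, hr, hrε⟩ := ENNReal.lt_iff_exists_real_btwn.1 hε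
      exact ⟨r, by simpa using hrε.1, hrε.2.le⟩
    filter_upwards [hu.eventually_lt_const (lt_min hδ one_pos)] with k hk
    exact ((u k).gagModular_le_of_norm_lt (min_le_right _ _) hk).trans
      ((ENNReal.ofReal_le_ofReal (min_le_left _ _)).trans hδε)
  · rw [Metric.tendsto_atTop']
    intro ε hε
    -- The norm estimate is not strict, so it is applied with ε/2.
    have h1 := ENNReal.Tendsto.const_mul (a := ENNReal.ofReal (max 1 (ε / 2)⁻¹ ^ expSup p)) hu
      (Or.inr ENNReal.ofReal_ne_top)
    rw [mul_zero] at h1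
    obtain ⟨n, hn⟩ := eventually_atTop.1 (h1.eventually_le_const zero_lt_one)
    refine ⟨n, fun k hk => ?_⟩
    rw [dist_zero_right, norm_norm]
    linarith [(u k).norm_le_of_gagModular_le (half_pos hε) (hn k hk.le)]

/-- The density of the Gagliardo modular of `u`. -/
def gagDensity (u : W h) (z : Eu N × Eu N) : ℝ :=
  |u z.1 - u z.2| ^ p z / ‖z.1 - z.2‖ ^ ((N : ℝ) + s * p z)

theorem gagDensity_nonneg (u : W h) (z : Eu N × Eu N) : 0 ≤ u.gagDensity z := by
  unfold gagDensity
  positivity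

theorem measurable_gagDensity (u : W h) : Measurable u.gagDensity := by
  have hp : Measurable p := h.cont.measurable
  have hu := u.measurable_coe
  unfold gagDensity
  fun_prop

theorem integrable_gagDensity (u : W h) : Integrable u.gagDensity := by
  refine ⟨u.measurable_gagDensity.aestronglyMeasurable, ?_⟩
  rw [hasFiniteIntegral_iff_ofReal (ae_of_all _ u.gagDensity_nonneg)]
  exact u.gagModular_lt_top

theorem integral_gagDensity (u : W h) : ∫ z, u.gagDensity z = (gagModular s p u).toReal :=
  integral_eq_lintegral_of_nonneg_ae (ae_of_all _ u.gagDensity_nonneg)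
    u.measurable_gagDensity.aestronglyMeasurable

/-- The difference `u(x) - u(y)`. -/
def diff (u : W h) (z : Eu N × Eu N) : ℝ := u z.1 - u z.2

theorem measurable_diff (u : W h) : Measurable u.diff :=
  (u.measurable_coe.comp measurable_fst).sub (u.measurable_coe.comp measurable_snd)

theorem diff_rpow_bounds {K : Eu N × Eu N → ℝ} {b₀ b₁ : ℝ}
    (hb : ∀ x y : Eu N, x ≠ y → b₀ ≤ K (x, y) * ‖x - y‖ ^ ((N : ℝ) + s * p (x, y)) ∧
      K (x, y) * ‖x - y‖ ^ ((N : ℝ) + s * p (x, y)) ≤ b₁) (u : W h) (z : Eu N × Eu N) :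
    b₀ * u.gagDensity z ≤ K z * |u.diff z| ^ p z ∧
      K z * |u.diff z| ^ p z ≤ b₁ * u.gagDensity z := by
  obtain ⟨x, y⟩ := z
  -- On the diagonal K is unrestricted, but the difference vanishes and 0^p = 0, so all terms are
  -- zero.
  rcases eq_or_ne x y with rfl | hxy
  · have hp : p (x, x) ≠ 0 := (one_pos.trans (h.one_lt _)).ne'
    simp [gagDensity, diff, Real.zero_rpow hp]
  · have h1 := hb x y hxy
    have hn : 0 < ‖x - y‖ ^ ((N : ℝ) + s * p (x, y)) :=
      Real.rpow_pos_of_pos (norm_pos_iff.2 (sub_ne_zero.2 hxy)) _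
    have h2 : K (x, y) * |u.diff (x, y)| ^ p (x, y) =
        K (x, y) * ‖x - y‖ ^ ((N : ℝ) + s * p (x, y)) * u.gagDensity (x, y) := by
      unfold gagDensity diff
      field_simp
    rw [h2]
    exact ⟨mul_le_mul_of_nonneg_right h1.1 (u.gagDensity_nonneg _),
      mul_le_mul_of_nonneg_right h1.2 (u.gagDensity_nonneg _)⟩

end W

/-! ### The measure with density `K` -/

/-- The measure `K(x, y) dx dy`. -/
def kernelMeasure (K : Eu N × Eu N → ℝ) : Measure (Eu N × Eu N) :=
  volume.withDensity fun z => ENNReal.ofReal (K z)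

theorem integrable_kernelMeasure {K : Eu N × Eu N → ℝ} (hK : KernelCond s p K)
    {g : Eu N × Eu N → ℝ} : Integrable g (kernelMeasure K) ↔ Integrable fun z => K z * g z := by
  unfold kernelMeasure
  rw [integrable_withDensity_iff_integrable_smul' hK.measurable.ennreal_ofReal
    (ae_of_all _ fun _ => ENNReal.ofReal_lt_top)]
  simp only [ENNReal.toReal_ofReal (hK.nonneg _), smul_eq_mul]

theorem integral_kernelMeasure {K : Eu N × Eu N → ℝ} (hK : KernelCond s p K)
    (g : Eu N × Eu N → ℝ) : ∫ z, g z ∂kernelMeasure K = ∫ z, K z * g z := by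
  unfold kernelMeasure
  rw [integral_withDensity_eq_integral_toReal_smul hK.measurable.ennreal_ofReal
    (ae_of_all _ fun _ => ENNReal.ofReal_lt_top)]
  simp only [ENNReal.toReal_ofReal (hK.nonneg _), smul_eq_mul]

theorem ae_kernelMeasure {K : Eu N × Eu N → ℝ} {Q : Eu N × Eu N → Prop} (hQ : ∀ᵐ z, Q z) :
    ∀ᵐ z ∂kernelMeasure K, Q z :=
  (withDensity_absolutelyContinuous _ _).ae_le hQ

theorem W.integrable_kernel_diff_rpow {h : Standing N s p Ω} {K : Eu N × Eu N → ℝ}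
    (hK : KernelCond s p K) (u : W h) : Integrable fun z => K z * |u.diff z| ^ p z := by
  obtain ⟨b₀, b₁, -, -, hb⟩ := hK.bounds
  have hm := hK.measurable
  have hp : Measurable p := h.cont.measurable
  have hu := u.measurable_diff
  refine (u.integrable_gagDensity.const_mul b₁).mono'
    (Measurable.aestronglyMeasurable (by fun_prop)) (ae_of_all _ fun z => ?_)
  have := hK.nonneg z
  rw [Real.norm_of_nonneg (by positivity)]
  exact (u.diff_rpow_bounds hb z).2

theorem isModularMap_diff (h : Standing N s p Ω) {K : Eu N × Eu N → ℝ} (hK : KernelCond s p K) :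
    IsModularMap (kernelMeasure K) p (W.diff : W h → Eu N × Eu N → ℝ) := by
  obtain ⟨b₀, b₁, hb₀, hb₁, hb⟩ := hK.bounds
  have hlow : ∀ u : W h, b₀ * (gagModular s p u).toReal ≤
      ∫ z, |u.diff z| ^ p z ∂kernelMeasure K := fun u => by
    rw [integral_kernelMeasure hK, ← u.integral_gagDensity, ← integral_const_mul]
    exact integral_mono (u.integrable_gagDensity.const_mul _) (u.integrable_kernel_diff_rpow hK)
      fun z => (u.diff_rpow_bounds hb z).1
  have hupp : ∀ u : W h, ∫ z, |u.diff z| ^ p z ∂kernelMeasure K ≤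
      b₁ * (gagModular s p u).toReal := fun u => by
    rw [integral_kernelMeasure hK, ← u.integral_gagDensity, ← integral_const_mul]
    exact integral_mono (u.integrable_kernel_diff_rpow hK) (u.integrable_gagDensity.const_mul _)
      fun z => (u.diff_rpow_bounds hb z).2
  refine ⟨W.measurable_diff, fun u v => ?_, fun c u => ?_, fun u => ?_, ?_, fun u => ?_⟩
  · refine ae_kernelMeasure ?_
    -- Representatives add only a.e. on ℝ^N; `ae_fst_snd` carries this to the product, and
    -- `kernelMeasure` is absolutely continuous.
    filter_upwards [ae_fst_snd (AEEqFun.coeFn_add u.toClass v.toClass)] with z hz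
    change (u.toClass + v.toClass) z.1 - (u.toClass + v.toClass) z.2 =
      u.toClass z.1 - u.toClass z.2 + (v.toClass z.1 - v.toClass z.2)
    rw [hz.1, hz.2, Pi.add_apply, Pi.add_apply]
    ring
  · refine ae_kernelMeasure ?_
    filter_upwards [ae_fst_snd (AEEqFun.coeFn_smul c u.toClass)] with z hz
    change (c • u.toClass) z.1 - (c • u.toClass) z.2 = c * (u.toClass z.1 - u.toClass z.2)
    rw [hz.1, hz.2, Pi.smul_apply, Pi.smul_apply, smul_eq_mul, smul_eq_mul, mul_sub]
  · exact (integrable_kernelMeasure hK).2 (u.integrable_kernel_diff_rpow hK)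
  · refine ⟨b₁ * 2 ^ expSup p, fun u hu => (hupp u).trans ?_⟩
    refine mul_le_mul_of_nonneg_left ?_ (hb₀.le.trans hb₁)
    exact ENNReal.toReal_le_of_le_ofReal (by positivity) (u.gagModular_le_of_norm_le_one hu)
  · rw [W.tendsto_zero_iff_gagModular, ← ENNReal.tendsto_toReal_iff
      (fun k => (u k).gagModular_lt_top.ne) ENNReal.zero_ne_top, ENNReal.toReal_zero]
    refine ⟨fun h1 => ?_, fun h1 => ?_⟩
    · have h2 := h1.const_mul b₁
      rw [mul_zero] at h2
      exact squeeze_zero (fun k => integral_nonneg fun z => by positivity) (fun k => hupp (u k)) h2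
    · have h2 := h1.const_mul b₀⁻¹
      rw [mul_zero] at h2
      refine squeeze_zero (fun k => ENNReal.toReal_nonneg) (fun k => ?_) h2
      rw [inv_mul_eq_div, le_div_iff₀' hb₀]
      exact hlow (u k)

/-! ### The primitive of the nonlinearity -/

section Primitive

variable {A : Eu N × Eu N → ℝ → ℝ}

/-- The integral of an odd function is even in its endpoint, so the absolute value can be dropped;
differentiability at 0 is then immediate. -/
theorem primA_eq_integral (hA : NonlinearityCond p A) (z : Eu N × Eu N) (t : ℝ) :
    primA A z t = ∫ τ in (0 : ℝ)..t, A z τ := by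
  unfold primA
  rcases abs_choice t with ht | ht
  · rw [ht]
  · rw [ht]
    have h1 := intervalIntegral.integral_comp_neg (a := 0) (b := t) (A z)
    simp only [hA.odd, neg_zero, intervalIntegral.integral_neg] at h1
    rw [intervalIntegral.integral_symm, ← h1, neg_neg]

/-- Moving the variable endpoint into the integrand reduces joint measurability to that of an
integral with parameters over a fixed set. -/
theorem primA_eq_mul_integral (hA : NonlinearityCond p A) (z : Eu N × Eu N) (t : ℝ) :
    primA A z t = t * ∫ σ in Set.Ioc (0 : ℝ) 1, A z (t * σ) := by
  rw [primA_eq_integral hA, ← intervalIntegral.integral_of_le zero_le_one,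
    intervalIntegral.mul_integral_comp_mul_left, mul_zero, mul_one]

theorem measurable_primA (hA : NonlinearityCond p A) :
    Measurable (Function.uncurry (primA A)) := by
  have h1 : StronglyMeasurable (Function.uncurry
      fun (w : (Eu N × Eu N) × ℝ) (σ : ℝ) => A w.1 (w.2 * σ)) := by
    have h2 : Measurable fun v : ((Eu N × Eu N) × ℝ) × ℝ => (v.1.1, v.1.2 * v.2) := by fun_prop
    exact (hA.measurable.comp h2).stronglyMeasurable
  have h3 := (h1.integral_prod_right (ν := volume.restrict (Set.Ioc (0 : ℝ) 1))).measurable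
  have h4 : Function.uncurry (primA A) =
      fun w => w.2 * ∫ σ in Set.Ioc (0 : ℝ) 1, A w.1 (w.2 * σ) :=
    funext fun w => primA_eq_mul_integral hA w.1 w.2
  rw [h4]
  exact measurable_snd.mul h3

theorem hasDerivAt_primA (hA : NonlinearityCond p A) (z : Eu N × Eu N) (t : ℝ) :
    HasDerivAt (primA A z) (A z t) t := by
  rw [show primA A z = fun t => ∫ τ in (0 : ℝ)..t, A z τ from funext (primA_eq_integral hA z)]
  exact (hA.continuous z).integral_hasStrictDerivAt 0 t |>.hasDerivAt

theorem abs_primA_le (hA : NonlinearityCond p A) {C : ℝ} {z : Eu N × Eu N} (hz : 1 < p z)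
    (hC : ∀ t, |A z t| ≤ C * |t| ^ (p z - 1)) (hC0 : 0 ≤ C) (t : ℝ) :
    |primA A z t| ≤ C * |t| ^ p z := by
  rw [primA_eq_integral hA, ← rpow_sub_one_mul_self (abs_nonneg t) hz, ← mul_assoc]
  have h1 := intervalIntegral.norm_integral_le_of_norm_le_const (a := 0) (b := t) (f := A z)
    (C := C * |t| ^ (p z - 1)) fun τ hτ => by
      refine (hC τ).trans ?_
      have : |τ| ≤ |t| := by
        have := Set.abs_sub_left_of_mem_uIcc (Set.uIoc_subset_uIcc hτ)
        simpa using this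
      gcongr
  rwa [sub_zero] at h1

theorem exists_isPotential (h : Standing N s p Ω) (hA : NonlinearityCond p A) :
    ∃ c C, IsPotential p A (primA A) (expInf p) (expSup p) c C := by
  obtain ⟨c, C, hc, hC, hg⟩ := hA.growth
  exact ⟨c, C, h.cont.measurable, h.one_lt_inf, h.expInf_le, h.le_expSup, hA.measurable,
    hA.continuous, measurable_primA hA, hasDerivAt_primA hA, hA.strictConvex, hc, hC,
    fun z t => (hg z t).1, fun z t => (hg z t).2,
    fun z t => abs_primA_le hA (h.one_lt z) (fun t => (hg z t).2) hC.le t⟩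

end Primitive

theorem Phi_eq_integral (h : Standing N s p Ω) (A : Eu N × Eu N → ℝ → ℝ) {K : Eu N × Eu N → ℝ}
    (hK : KernelCond s p K) :
    Phi h A K = fun u : W h => ∫ z, primA A z (u.diff z) ∂kernelMeasure K := by
  funext u
  rw [integral_kernelMeasure hK]
  simp only [mul_comm (K _)]
  rfl

end Gagliardo

end FracVar

end

/-! ### The functional Φ on `W` -/

theorem lemma2p13 (N : ℕ) (s : ℝ) (p : FracVar.Eu N × FracVar.Eu N → ℝ) (Ω : Set (FracVar.Eu N))
    (h : FracVar.Standing N s p Ω)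
    (A : FracVar.Eu N × FracVar.Eu N → ℝ → ℝ) (hA : FracVar.NonlinearityCond p A)
    (K : FracVar.Eu N × FracVar.Eu N → ℝ) (hK : FracVar.KernelCond s p K) :
    -- `Φ` is well defined and of class `C¹`, with the stated derivative
    ((∀ u : FracVar.W h,
        Integrable (fun z : FracVar.Eu N × FracVar.Eu N =>
          FracVar.primA A z (u z.1 - u z.2) * K z)) ∧
      ContDiff ℝ 1 (FracVar.Phi h A K) ∧
      ∀ u v : FracVar.W h,
        Integrable (fun z : FracVar.Eu N × FracVar.Eu N =>
          A z (u z.1 - u z.2) * (v z.1 - v z.2) * K z) ∧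
        fderiv ℝ (FracVar.Phi h A K) u v =
          ∫ z : FracVar.Eu N × FracVar.Eu N, A z (u z.1 - u z.2) * (v z.1 - v z.2) * K z) ∧
    -- `Φ` is weakly (sequentially) lower semicontinuous
    (∀ (u : ℕ → FracVar.W h) (v : FracVar.W h), FracVar.WeakTendsto u v →
      (FracVar.Phi h A K v : EReal) ≤
        liminf (fun k => (FracVar.Phi h A K (u k) : EReal)) atTop) ∧
    -- `Φ'` is of type `(S₊)`
    (∀ (u : ℕ → FracVar.W h) (v : FracVar.W h), FracVar.WeakTendsto u v →
      limsup (fun k => (fderiv ℝ (FracVar.Phi h A K) (u k) (u k - v) : EReal)) atTop ≤ 0 →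
      Tendsto u atTop (𝓝 v)) := by
  obtain ⟨c, C, ha⟩ := FracVar.exists_isPotential h hA
  have hD := FracVar.isModularMap_diff h hK
  have hderiv : ∀ u : FracVar.W h, fderiv ℝ (FracVar.Phi h A K) u = ha.form hD u := fun u => by
    rw [FracVar.Phi_eq_integral h A hK]
    exact (ha.hasFDerivAt_integral hD u).fderiv
  refine ⟨⟨fun u => ?_, ?_, fun u v => ⟨?_, ?_⟩⟩, fun u v huv => ?_, fun u v huv hlim => ?_⟩
  · have := (FracVar.integrable_kernelMeasure hK).1 (ha.integrable_prim hD u)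
    simp only [mul_comm (K _)] at this
    exact this
  · rw [FracVar.Phi_eq_integral h A hK]
    exact ha.contDiff_integral hD
  · have := (FracVar.integrable_kernelMeasure hK).1 (ha.integrable_mul hD u v)
    simp only [mul_comm (K _)] at this
    exact this
  · rw [hderiv, ha.form_apply, FracVar.integral_kernelMeasure hK]
    simp only [mul_comm (K _)]
    rfl
  · rw [FracVar.Phi_eq_integral h A hK]
    exact ha.le_liminf_integral hD huv
  · simp only [hderiv] at hlim
    exact ha.tendsto_of_limsup_form_le hD huv hlim
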